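/- Let $D\subset\mathbb R^2$ be a bounded, strictly convex domain whose boundary $\Gamma$ is a $C^2$ closed curve of length $|\Gamma|$, parametrized counterclockwise by arc length, and let $M=\{(s,\theta):0\le s<|\Gamma|,\ 0\le\theta\le\pi\}$, where $\theta$ is the angle between the inward unit velocity $v$ and the oriented tangent at the point of $\Gamma$ with parameter $s$. Let $T:M\to M$ be the billiard map of $D$: $T(q_0,v_0)=(q_1,v_1)$, where $q_1$ is the point where the oriented line through $(q_0,v_0)$ hits $\Gamma$ next ($q_1=q_0$ if $v_0$ is tangent) and $v_1=v_0-2\langle n(q_1),v_0\rangle n(q_1)$, with $n$ the inner unit normal. For $0<\epsilon<\pi/2$ put $\theta^\epsilon=\min\{\max(\theta,\epsilon),\pi-\epsilon\}$ and let $Q^\epsilon_{(s,\theta)}(A)=\frac1{2\epsilon}\int_{\theta^\epsilon-\epsilon}^{\theta^\epsilon+\epsilon}\mathbf 1_A(s,u)\,du$. Consider the Markov kernel $P_\epsilon(x,A)=Q^\epsilon_{Tx}(A)$ on $M$ and its powers $P^{n+1}_\epsilon(x,A)=\int_M P_\epsilon(x,dy)P^n_\epsilon(y,A)$, with $P^0_\epsilon(x,A)=\mathbf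 1_A(x)$. Then for every $0<\epsilon<\pi/2$ there exist $b>0$ and an integer $N>0$ such that $P^N_\epsilon$ has a transition density $p^N_\epsilon$ with respect to $ds\,d\theta$, that is, a jointly measurable function with $P^N_\epsilon(x,A)=\int_A p^N_\epsilon(x,y)\,dy$ for all $x\in M$ and all Borel sets $A\subseteq M$, which satisfies $$p^N_\epsilon(x,y)>b\qquad\text{for all }x,y\in M.$$ Consequently, any other jointly measurable transition density of $P^N_\epsilon$ exceeds $b$, for every $x\in M$, at Lebesgue-almost every $y\in M$. -/

import Mathlib

open Set Filter Topology MeasureTheory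
open scoped NNReal ENNReal

noncomputable section

namespace Billiard

/-- A bounded planar domain (the plane is `ℂ`) that is strictly convex: it is open, non-empty,
bounded and convex, and its boundary contains no segment. -/
structure IsStrictlyConvexDomain (D : Set ℂ) : Prop where
  isOpen : IsOpen D
  nonempty : D.Nonempty
  isBounded : Bornology.IsBounded D
  convex : Convex ℝ D
  strictConvex_closure : StrictConvex ℝ (closure D)

/-- The boundary `Γ` of `D` is a simple closed `C²` curve of length `L`, and `γ` is an arc-length
parametrization of it (extended `L`-periodically to the line), oriented counterclockwise: the
normal `I * γ'(s)` to the left of the oriented tangent line points towards the interior of `D`. -/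
structure IsC2ArcLengthParam (D : Set ℂ) (L : ℝ) (γ : ℝ → ℂ) : Prop where
  length_pos : 0 < L
  contDiff : ContDiff ℝ 2 γ
  periodic : Function.Periodic γ L
  unit_speed : ∀ s, ‖deriv γ s‖ = 1
  injOn : InjOn γ (Ico 0 L)
  range_eq : range γ = frontier D
  interior_left : ∀ s, ∀ᶠ t : ℝ in 𝓝[>] 0, γ s + t * (Complex.I * deriv γ s) ∈ D

/-- The phase space `M = {(s, θ) : 0 ≤ s < |Γ|, 0 ≤ θ ≤ π}`. -/
def phaseSpace (L : ℝ) : Set (ℝ × ℝ) := Ico 0 L ×ˢ Icc 0 Real.pi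

/-- The inner unit normal at the point of the boundary with parameter `s`. -/
def innerNormal (γ : ℝ → ℂ) (s : ℝ) : ℂ := Complex.I * deriv γ s

/-- The inward unit vector at the point `γ s` that makes the angle `θ` with the oriented tangent. -/
def velocity (γ : ℝ → ℂ) (x : ℝ × ℝ) : ℂ :=
  Real.cos x.2 * deriv γ x.1 + Real.sin x.2 * innerNormal γ x.1

/-- The length of the chord which starts at `γ s` in the direction of the velocity: the largest
`t ≥ 0` with `γ s + t v` on the boundary (it is `0` when the velocity is tangent). -/
def chordLength (D : Set ℂ) (γ : ℝ → ℂ) (x : ℝ × ℝ) : ℝ :=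
  sSup {t : ℝ | 0 ≤ t ∧ γ x.1 + t * velocity γ x ∈ frontier D}

/-- The next collision point `q₁`. -/
def nextPoint (D : Set ℂ) (γ : ℝ → ℂ) (x : ℝ × ℝ) : ℂ :=
  γ x.1 + chordLength D γ x * velocity γ x

/-- The arc-length parameter in `[0, L)` of the next collision point. -/
def nextParam (D : Set ℂ) (L : ℝ) (γ : ℝ → ℂ) (x : ℝ × ℝ) : ℝ :=
  Function.invFunOn γ (Ico 0 L) (nextPoint D γ x)

/-- The velocity after the elastic reflection, `v₁ = v₀ - 2 ⟨n(q₁), v₀⟩ n(q₁)`. -/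
def reflectedVelocity (D : Set ℂ) (L : ℝ) (γ : ℝ → ℂ) (x : ℝ × ℝ) : ℂ :=
  velocity γ x -
    (2 * inner ℝ (innerNormal γ (nextParam D L γ x)) (velocity γ x) : ℝ) *
      innerNormal γ (nextParam D L γ x)

/-- The deterministic billiard map `T` in the coordinates `(s, θ)`. -/
def billiardMap (D : Set ℂ) (L : ℝ) (γ : ℝ → ℂ) (x : ℝ × ℝ) : ℝ × ℝ :=
  (nextParam D L γ x,
    InnerProductGeometry.angle (reflectedVelocity D L γ x) (deriv γ (nextParam D L γ x)))

/-- The truncated angle `θ^ε = min (max θ ε) (π - ε)`. -/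
def truncAngle (ε θ : ℝ) : ℝ := min (max θ ε) (Real.pi - ε)

/-- The perturbation `Q^ε_x`: the position is kept and the angle is uniformly distributed on
`[θ^ε - ε, θ^ε + ε]`. -/
def perturbation (ε : ℝ) (x : ℝ × ℝ) : Measure (ℝ × ℝ) :=
  ENNReal.ofReal (1 / (2 * ε)) •
    (volume.restrict (Icc (truncAngle ε x.2 - ε) (truncAngle ε x.2 + ε))).map
      (fun u : ℝ => (x.1, u))

/-- The transition kernel `P_ε(x, ·) = Q^ε_{T x}` of the randomly perturbed billiard. -/
def transition (D : Set ℂ) (L : ℝ) (γ : ℝ → ℂ) (ε : ℝ) (x : ℝ × ℝ) : Measure (ℝ × ℝ) :=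
  perturbation ε (billiardMap D L γ x)

/-- The `n`-step transition probabilities: `P⁰(x, A) = 1_A(x)` and
`P^{n+1}(x, A) = ∫_M P(x, dy) Pⁿ(y, A)`. -/
def nStep (D : Set ℂ) (L : ℝ) (γ : ℝ → ℂ) (ε : ℝ) : ℕ → ℝ × ℝ → Set (ℝ × ℝ) → ℝ≥0∞
  | 0, x, A => A.indicator 1 x
  | n + 1, x, A => ∫⁻ y in phaseSpace L, nStep D L γ ε n y A ∂(transition D L γ ε x)

/-- `p` is an `n`-step transition density with respect to `ds dθ`: it is jointly measurable, and
`Pⁿ(x, A) = ∫_A p(x, y) dy` for all `x ∈ M` and all Borel sets `A ⊆ M`. -/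
def IsTransitionDensity (D : Set ℂ) (L : ℝ) (γ : ℝ → ℂ) (ε : ℝ) (n : ℕ)
    (p : ℝ × ℝ → ℝ × ℝ → ℝ≥0) : Prop :=
  Measurable (Function.uncurry p) ∧
    ∀ x ∈ phaseSpace L, ∀ A ⊆ phaseSpace L, MeasurableSet A →
      nStep D L γ ε n x A = ∫⁻ y in A, p x y

end Billiard

end

noncomputable section

namespace Billiard

variable {D : Set ℂ} {L : ℝ} {γ : ℝ → ℂ} {ε : ℝ}

/-! A chord is described by the parameters `(s, t)` of its ends; for fixed `s`, the departure angle
and `t` determine each other by a monotone change of variables. One round "perturb the angle, then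
follow the chord" becomes the positive operator `chordOp`, an integral over end points, and
`nStep_succ_eq` expresses P^{n+1}(x, A) as the n-th iterate of `chordOp` on `angleOp ε (A.indicator
1)`, evaluated at T x. It remains to bound such iterates below by a multiple of `volume A`,
uniformly in the state (`exists_minorization`).

Reachability is a measure argument. In chord coordinates sin θ ds dθ is ds dt times the product of
the sines of the two end angles over the chord length; this is symmetric, so T preserves it. Let C
be the set of states from which a given open set V is never charged. From (s, θ) in C, almost every
angle of (0, π) within ε of θ is sent by T into C. So T⁻¹C contains, up to null sets, the
ε-thickening of every angular section of C. It has the same finite measure as C, hence almost every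
nonempty section agrees almost everywhere with its thickening, and by connectedness of (0, π) it has
full measure. A full section sends chords to almost every boundary point, so C is conull
(`ae_mem_of_absorbing`), which is impossible when V meets the interior of the phase space.

Doeblin's condition then follows by compactness. Near each z the process has a density bounded below
when started in a suitable open V (`exists_local_minorization`). Finitely many such V suffice, but
they must be reached at one common time. Short, nearly tangent chords provide the aperiodicity: a
small box around a tangent vector can be kept occupied (`chordOp_box_ne_zero`), so once it is
charged it stays charged. Lower semicontinuity of the iterates makes positivity an open condition
and gives positive minima on compact sets. -/

/-- The angle at `γ s` between the oriented tangent and the chord from `γ s` to `γ t`. -/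
def chordAngle (γ : ℝ → ℂ) (s t : ℝ) : ℝ := Complex.arg ((γ t - γ s) / deriv γ s)

/-- The derivative of `chordAngle γ s` at `t`. -/
def chordAngleDeriv (γ : ℝ → ℂ) (s t : ℝ) : ℝ := (deriv γ t / (γ t - γ s)).im

/-- The angle at which the chord from `γ s` arrives at `γ t`. -/
def arrivalAngle (γ : ℝ → ℂ) (s t : ℝ) : ℝ := Real.pi - chordAngle γ t s

/-! ### Geometry of the chords -/

namespace IsC2ArcLengthParam

theorem hasDerivAt (hγ : IsC2ArcLengthParam D L γ) (s : ℝ) : HasDerivAt γ (deriv γ s) s :=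
  (hγ.contDiff.differentiable (by norm_num) s).hasDerivAt

theorem continuous (hγ : IsC2ArcLengthParam D L γ) : Continuous γ := hγ.contDiff.continuous

theorem continuous_deriv (hγ : IsC2ArcLengthParam D L γ) : Continuous (deriv γ) :=
  hγ.contDiff.continuous_deriv (by norm_num)

theorem deriv_ne_zero (hγ : IsC2ArcLengthParam D L γ) (s : ℝ) : deriv γ s ≠ 0 := by
  intro h
  have := hγ.unit_speed s
  simp [h] at this

theorem periodic_deriv (hγ : IsC2ArcLengthParam D L γ) : Function.Periodic (deriv γ) L := by
  intro s
  have h : (fun x => γ (x + L)) = γ := funext hγ.periodic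
  rw [← deriv_comp_add_const, h]

theorem mem_frontier (hγ : IsC2ArcLengthParam D L γ) (s : ℝ) : γ s ∈ frontier D :=
  hγ.range_eq ▸ mem_range_self s

theorem exists_mem_Ico (hγ : IsC2ArcLengthParam D L γ) {z : ℂ} (hz : z ∈ frontier D) :
    ∃ t ∈ Ico 0 L, γ t = z := by
  rw [← hγ.range_eq] at hz
  obtain ⟨t, rfl⟩ := hz
  obtain ⟨y, hy, h⟩ := hγ.periodic.exists_mem_Ico₀ hγ.length_pos t
  exact ⟨y, hy, h.symm⟩

theorem apply_ne_of_mem_Ioo (hγ : IsC2ArcLengthParam D L γ) {s t : ℝ} (h : t ∈ Ioo s (s + L)) :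
    γ t ≠ γ s := by
  intro he
  have hL := hγ.length_pos
  have key : ∀ x, γ (toIcoMod hL 0 x) = γ x := fun x => by
    rw [toIcoMod, hγ.periodic.sub_zsmul_eq]
  have h2 : toIcoMod hL 0 t = toIcoMod hL 0 s := by
    refine hγ.injOn ?_ ?_ (by rw [key, key, he])
    · simpa using toIcoMod_mem_Ico hL 0 t
    · simpa using toIcoMod_mem_Ico hL 0 s
  have h3 : toIcoMod hL s t = t := (toIcoMod_eq_self hL).2 ⟨h.1.le, h.2⟩
  have h4 : toIcoMod hL s s = s := toIcoMod_apply_left hL s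
  have h5 : toIcoMod hL s t = toIcoMod hL s s := by
    rw [toIcoMod_inj] at h2 ⊢
    exact h2
  rw [h3, h4] at h5
  exact h.1.ne' h5

/-- The boundary lies strictly to the left of each of its tangents. -/
theorem im_chord_pos (hγ : IsC2ArcLengthParam D L γ) (hD : IsStrictlyConvexDomain D) {s t : ℝ}
    (hne : γ t ≠ γ s) : 0 < ((γ t - γ s) / deriv γ s).im := by
  have hs : γ s ∉ D := by
    have := hγ.mem_frontier s
    rw [hD.isOpen.frontier_eq] at this
    exact this.2
  obtain ⟨f, hf⟩ := geometric_hahn_banach_open_point hD.convex hD.isOpen hs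
  have hcl : ∀ z ∈ closure D, f z ≤ f (γ s) := fun z hz =>
    closure_minimal (fun a ha => (hf a ha).le) (isClosed_le f.continuous continuous_const) hz
  -- `f ∘ γ` is maximal at `s`, so the supporting line is the tangent.
  have hder : f (deriv γ s) = 0 := by
    have h1 : HasDerivAt (fun t => f (γ t)) (f (deriv γ s)) s :=
      (f.hasFDerivAt.comp_hasDerivAt s (hγ.hasDerivAt s))
    refine IsLocalMax.hasDerivAt_eq_zero (Eventually.of_forall fun t => ?_) h1
    exact hcl _ (frontier_subset_closure (hγ.mem_frontier t))
  have hn : f (Complex.I * deriv γ s) < 0 := by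
    obtain ⟨r, hr, hr0⟩ := ((hγ.interior_left s).and self_mem_nhdsWithin).exists
    have h1 := hf _ hr
    have h2 : (r : ℂ) * (Complex.I * deriv γ s) = r • (Complex.I * deriv γ s) := by simp
    rw [h2, map_add, map_smul, smul_eq_mul] at h1
    have hr0 : 0 < r := hr0
    by_contra hcon
    push Not at hcon
    nlinarith [mul_nonneg hr0.le hcon]
  have hdec : ∀ w : ℂ, f w = (w / deriv γ s).im * f (Complex.I * deriv γ s) := by
    intro w
    have h1 : w = (w / deriv γ s).re • deriv γ s +
        (w / deriv γ s).im • (Complex.I * deriv γ s) := by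
      have h2 : w = (w / deriv γ s) * deriv γ s := by
        field_simp [hγ.deriv_ne_zero s]
      conv_lhs => rw [h2, ← Complex.re_add_im (w / deriv γ s)]
      simp only [Complex.real_smul]
      ring
    conv_lhs => rw [h1]
    rw [map_add, map_smul, map_smul, hder]
    simp
  -- Strict convexity puts the midpoint of the chord in the open set `D`, which makes the inequality
  -- strict.
  have hlt : f (γ t - γ s) < 0 := by
    have hmid : (1 / 2 : ℝ) • γ t + (1 / 2 : ℝ) • γ s ∈ D := by
      have h := hD.strictConvex_closure (frontier_subset_closure (hγ.mem_frontier t))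
        (frontier_subset_closure (hγ.mem_frontier s)) hne (a := 1 / 2) (b := 1 / 2)
        (by norm_num) (by norm_num) (by norm_num)
      rw [hD.convex.interior_closure_eq_interior_of_nonempty_interior
        (by rw [hD.isOpen.interior_eq]; exact hD.nonempty), hD.isOpen.interior_eq] at h
      exact h
    have h2 := hf _ hmid
    rw [map_add, map_smul, map_smul, smul_eq_mul, smul_eq_mul] at h2
    rw [map_sub]
    linarith
  rw [hdec] at hlt
  by_contra hcon
  push Not at hcon
  nlinarith [mul_nonneg_of_nonpos_of_nonpos hcon hn.le]

theorem chordAngle_mem (hγ : IsC2ArcLengthParam D L γ) (hD : IsStrictlyConvexDomain D) {s t : ℝ}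
    (hne : γ t ≠ γ s) : chordAngle γ s t ∈ Ioo 0 Real.pi := by
  have h := hγ.im_chord_pos hD hne
  have h0 : 0 ≤ chordAngle γ s t := Complex.arg_nonneg_iff.2 h.le
  refine ⟨lt_of_le_of_ne h0 fun h1 => ?_, lt_of_le_of_ne (Complex.arg_le_pi _) fun h1 => ?_⟩
  · exact h.ne' (Complex.arg_eq_zero_iff.1 h1.symm).2
  · exact h.ne' (Complex.arg_eq_pi_iff.1 h1).2

theorem arrivalAngle_mem (hγ : IsC2ArcLengthParam D L γ) (hD : IsStrictlyConvexDomain D) {s t : ℝ}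
    (hne : γ t ≠ γ s) : arrivalAngle γ s t ∈ Ioo 0 Real.pi := by
  have := hγ.chordAngle_mem hD hne.symm
  simp only [arrivalAngle, mem_Ioo] at *
  constructor <;> linarith [this.1, this.2]

theorem chordAngle_mem_Icc (hγ : IsC2ArcLengthParam D L γ) (hD : IsStrictlyConvexDomain D)
    (s t : ℝ) : chordAngle γ s t ∈ Icc 0 Real.pi := by
  by_cases h : γ t = γ s
  · simp [chordAngle, h, Real.pi_pos.le]
  · exact Ioo_subset_Icc_self (hγ.chordAngle_mem hD h)

theorem arrivalAngle_mem_Icc (hγ : IsC2ArcLengthParam D L γ) (hD : IsStrictlyConvexDomain D)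
    (s t : ℝ) : arrivalAngle γ s t ∈ Icc 0 Real.pi := by
  have := hγ.chordAngle_mem_Icc hD t s
  simp only [arrivalAngle, mem_Icc] at *
  constructor <;> linarith [this.1, this.2]

theorem periodic_chordAngle_left (hγ : IsC2ArcLengthParam D L γ) (s t : ℝ) :
    chordAngle γ (s + L) t = chordAngle γ s t := by
  simp only [chordAngle, hγ.periodic s, hγ.periodic_deriv s]

theorem periodic_chordAngleDeriv_left (hγ : IsC2ArcLengthParam D L γ) (s t : ℝ) :
    chordAngleDeriv γ (s + L) t = chordAngleDeriv γ s t := by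
  simp only [chordAngleDeriv, hγ.periodic s]

theorem periodic_arrivalAngle_left (hγ : IsC2ArcLengthParam D L γ) (s t : ℝ) :
    arrivalAngle γ (s + L) t = arrivalAngle γ s t := by
  simp only [arrivalAngle, chordAngle, hγ.periodic s]

theorem norm_chord_div (hγ : IsC2ArcLengthParam D L γ) (s t : ℝ) :
    ‖(γ t - γ s) / deriv γ s‖ = ‖γ t - γ s‖ := by
  rw [norm_div, hγ.unit_speed, div_one]

/-- A boundary element dt at distance r, met by the chord at angle α, subtends the angle sin α dt /
r. -/
theorem chordAngleDeriv_eq (hγ : IsC2ArcLengthParam D L γ) {s t : ℝ} (hne : γ t ≠ γ s) :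
    chordAngleDeriv γ s t = Real.sin (chordAngle γ t s) / ‖γ t - γ s‖ := by
  have h1 : deriv γ t / (γ t - γ s) = -((γ s - γ t) / deriv γ t)⁻¹ := by
    rw [inv_div, ← neg_sub (γ t) (γ s), div_neg, neg_neg]
  have h2 : ‖γ s - γ t‖ ≠ 0 := by
    rw [norm_ne_zero_iff, sub_ne_zero]; exact hne.symm
  rw [chordAngleDeriv, h1, Complex.neg_im, Complex.inv_im, Complex.normSq_eq_norm_sq, chordAngle,
    Complex.sin_arg, hγ.norm_chord_div, norm_sub_rev (γ t)]
  field_simp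

theorem chordAngleDeriv_pos (hγ : IsC2ArcLengthParam D L γ) (hD : IsStrictlyConvexDomain D)
    {s t : ℝ} (hne : γ t ≠ γ s) : 0 < chordAngleDeriv γ s t := by
  rw [hγ.chordAngleDeriv_eq hne]
  have h := hγ.chordAngle_mem hD hne.symm
  exact div_pos (Real.sin_pos_of_pos_of_lt_pi h.1 h.2) (norm_pos_iff.2 (sub_ne_zero.2 hne))

/-- The density of the invariant measure of the billiard map in the coordinates
`(s, t)` of a chord is symmetric. -/
theorem sin_mul_chordAngleDeriv_comm (hγ : IsC2ArcLengthParam D L γ) (s t : ℝ) :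
    Real.sin (chordAngle γ s t) * chordAngleDeriv γ s t =
      Real.sin (chordAngle γ t s) * chordAngleDeriv γ t s := by
  by_cases hne : γ t = γ s
  · simp [chordAngleDeriv, hne]
  · rw [hγ.chordAngleDeriv_eq hne, hγ.chordAngleDeriv_eq (Ne.symm hne), norm_sub_rev]
    ring

theorem mem_slitPlane (hγ : IsC2ArcLengthParam D L γ) (hD : IsStrictlyConvexDomain D) {s t : ℝ}
    (hne : γ t ≠ γ s) : (γ t - γ s) / deriv γ s ∈ Complex.slitPlane :=
  Or.inr (hγ.im_chord_pos hD hne).ne'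

theorem hasDerivAt_chordAngle (hγ : IsC2ArcLengthParam D L γ) (hD : IsStrictlyConvexDomain D)
    {s t : ℝ} (hne : γ t ≠ γ s) :
    HasDerivAt (chordAngle γ s) (chordAngleDeriv γ s t) t := by
  have h1 : HasDerivAt (fun t => (γ t - γ s) / deriv γ s) (deriv γ t / deriv γ s) t :=
    ((hγ.hasDerivAt t).sub_const _).div_const _
  have h2 := h1.clog_real (hγ.mem_slitPlane hD hne)
  have h3 := Complex.imCLM.hasFDerivAt.comp_hasDerivAt t h2
  have h4 : deriv γ t / deriv γ s / ((γ t - γ s) / deriv γ s) = deriv γ t / (γ t - γ s) := by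
    rw [div_div_div_cancel_right₀ (hγ.deriv_ne_zero s)]
  rw [h4] at h3
  refine h3.congr_of_eventuallyEq (Eventually.of_forall fun t => ?_)
  exact (Complex.log_im _).symm

theorem continuousAt_chordAngle (hγ : IsC2ArcLengthParam D L γ) (hD : IsStrictlyConvexDomain D)
    {x : ℝ × ℝ} (hne : γ x.2 ≠ γ x.1) :
    ContinuousAt (fun x : ℝ × ℝ => chordAngle γ x.1 x.2) x := by
  have h1 : ContinuousAt (fun x : ℝ × ℝ => (γ x.2 - γ x.1) / deriv γ x.1) x := by
    refine ContinuousAt.div ?_ ?_ (hγ.deriv_ne_zero _)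
    · exact ((hγ.continuous.comp continuous_snd).sub
        (hγ.continuous.comp continuous_fst)).continuousAt
    · exact (hγ.continuous_deriv.comp continuous_fst).continuousAt
  exact ContinuousAt.comp (f := fun x : ℝ × ℝ => (γ x.2 - γ x.1) / deriv γ x.1)
    (Complex.continuousAt_arg (hγ.mem_slitPlane hD hne)) h1

theorem continuousAt_chordAngleDeriv (hγ : IsC2ArcLengthParam D L γ)
    {x : ℝ × ℝ} (hne : γ x.2 ≠ γ x.1) :
    ContinuousAt (fun x : ℝ × ℝ => chordAngleDeriv γ x.1 x.2) x := by
  have h1 : ContinuousAt (fun x : ℝ × ℝ => deriv γ x.2 / (γ x.2 - γ x.1)) x := by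
    refine ContinuousAt.div ?_ ?_ (sub_ne_zero.2 hne)
    · exact (hγ.continuous_deriv.comp continuous_snd).continuousAt
    · exact ((hγ.continuous.comp continuous_snd).sub
        (hγ.continuous.comp continuous_fst)).continuousAt
  exact Complex.continuous_im.continuousAt.comp h1

theorem continuousAt_arrivalAngle (hγ : IsC2ArcLengthParam D L γ) (hD : IsStrictlyConvexDomain D)
    {x : ℝ × ℝ} (hne : γ x.2 ≠ γ x.1) :
    ContinuousAt (fun x : ℝ × ℝ => arrivalAngle γ x.1 x.2) x := by
  have h := hγ.continuousAt_chordAngle hD (x := x.swap) (by simpa using hne.symm)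
  exact continuousAt_const.sub (h.comp (f := Prod.swap) continuous_swap.continuousAt)

theorem measurable_chordAngle (hγ : IsC2ArcLengthParam D L γ) :
    Measurable fun x : ℝ × ℝ => chordAngle γ x.1 x.2 := by
  have := hγ.continuous.measurable
  have := hγ.continuous_deriv.measurable
  unfold chordAngle
  fun_prop

theorem measurable_arrivalAngle (hγ : IsC2ArcLengthParam D L γ) :
    Measurable fun x : ℝ × ℝ => arrivalAngle γ x.1 x.2 :=
  measurable_const.sub (hγ.measurable_chordAngle.comp measurable_swap)

theorem measurable_chordAngleDeriv (hγ : IsC2ArcLengthParam D L γ) :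
    Measurable fun x : ℝ × ℝ => chordAngleDeriv γ x.1 x.2 := by
  have := hγ.continuous.measurable
  have := hγ.continuous_deriv.measurable
  unfold chordAngleDeriv
  fun_prop

theorem strictMonoOn_chordAngle (hγ : IsC2ArcLengthParam D L γ) (hD : IsStrictlyConvexDomain D)
    (s : ℝ) : StrictMonoOn (chordAngle γ s) (Ioo s (s + L)) := by
  refine strictMonoOn_of_deriv_pos (convex_Ioo _ _) (fun t ht => ?_) fun t ht => ?_
  · exact (hγ.hasDerivAt_chordAngle hD (hγ.apply_ne_of_mem_Ioo ht)).continuousAt.continuousWithinAt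
  · rw [interior_Ioo] at ht
    rw [(hγ.hasDerivAt_chordAngle hD (hγ.apply_ne_of_mem_Ioo ht)).deriv]
    exact hγ.chordAngleDeriv_pos hD (hγ.apply_ne_of_mem_Ioo ht)

theorem tendsto_slope (hγ : IsC2ArcLengthParam D L γ) (s : ℝ) :
    Tendsto (fun t : ℝ => (γ t - γ s) / ((t - s : ℝ) : ℂ)) (𝓝[≠] s) (𝓝 (deriv γ s)) := by
  have h := hasDerivAt_iff_tendsto_slope.1 (hγ.hasDerivAt s)
  refine h.congr fun t => ?_
  rw [slope_def_module, Complex.real_smul, Complex.ofReal_inv, div_eq_inv_mul]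

theorem tendsto_chordAngle_right (hγ : IsC2ArcLengthParam D L γ) (s : ℝ) :
    Tendsto (chordAngle γ s) (𝓝[>] s) (𝓝 0) := by
  have h1 := ((hγ.tendsto_slope s).mono_left (nhdsGT_le_nhdsNE s)).div_const (deriv γ s)
  rw [div_self (hγ.deriv_ne_zero s)] at h1
  have h2 := (Complex.continuousAt_arg Complex.one_mem_slitPlane).tendsto.comp h1
  rw [Complex.arg_one] at h2
  refine h2.congr' ?_
  filter_upwards [self_mem_nhdsWithin] with t ht
  have ht : 0 < t - s := sub_pos.2 ht
  simp only [Function.comp, chordAngle]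
  rw [div_right_comm, div_eq_inv_mul _ ((t - s : ℝ) : ℂ), ← Complex.ofReal_inv,
    Complex.arg_real_mul _ (inv_pos.2 ht)]

/-- For `t < s` the difference quotient, which tends to the tangent, is a negative multiple of the
chord; this shifts the argument by π. -/
theorem tendsto_chordAngle_left (hγ : IsC2ArcLengthParam D L γ) (hD : IsStrictlyConvexDomain D)
    (s : ℝ) : Tendsto (chordAngle γ s) (𝓝[<] s) (𝓝 Real.pi) := by
  have hL := hγ.length_pos
  have h1 := ((hγ.tendsto_slope s).mono_left (nhdsLT_le_nhdsNE s)).div_const (deriv γ s)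
  rw [div_self (hγ.deriv_ne_zero s)] at h1
  have h2 := (Complex.continuousAt_arg Complex.one_mem_slitPlane).tendsto.comp h1
  rw [Complex.arg_one] at h2
  have h3 := h2.add_const Real.pi
  rw [zero_add] at h3
  refine h3.congr' ?_
  filter_upwards [self_mem_nhdsWithin, mem_nhdsWithin_of_mem_nhds (Ioi_mem_nhds (sub_lt_self s hL))]
    with t ht ht2
  have ht : 0 < -(t - s) := by have : t < s := ht; linarith
  have hne : γ t ≠ γ s :=
    (hγ.apply_ne_of_mem_Ioo (s := t) (t := s) ⟨by linarith, by have : s - L < t := ht2; linarith⟩).symm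
  have him := hγ.im_chord_pos hD hne
  have h4 := Complex.arg_neg_eq_arg_sub_pi_of_im_pos him
  simp only [Function.comp, chordAngle]
  have h5 : (γ t - γ s) / ((t - s : ℝ) : ℂ) / deriv γ s =
      ((-(t - s))⁻¹ : ℝ) * (-((γ t - γ s) / deriv γ s)) := by
    push_cast
    rw [div_right_comm, inv_neg, neg_mul_neg, div_eq_inv_mul]
  rw [h5, Complex.arg_real_mul _ (inv_pos.2 ht), h4]
  ring

theorem periodic_chordAngle_right (hγ : IsC2ArcLengthParam D L γ) (s t : ℝ) :
    chordAngle γ s (t + L) = chordAngle γ s t := by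
  simp only [chordAngle, hγ.periodic t]

/-- Intermediate value theorem over one period: the chord turns from the tangent direction just
after `s` to the opposite direction just before `s + L`. -/
theorem exists_chordAngle_eq (hγ : IsC2ArcLengthParam D L γ) (hD : IsStrictlyConvexDomain D)
    (s : ℝ) {u : ℝ} (hu : u ∈ Ioo 0 Real.pi) :
    ∃ t ∈ Ico 0 L, γ t ≠ γ s ∧ chordAngle γ s t = u := by
  have hL := hγ.length_pos
  have hsL : s < s + L := by linarith
  have h2 : Tendsto (chordAngle γ s) (𝓝[<] (s + L)) (𝓝 Real.pi) := by
    have := hγ.tendsto_chordAngle_left hD (s + L)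
    exact this.congr fun t => hγ.periodic_chordAngle_left s t
  have := left_nhdsWithin_Ioo_neBot hsL
  have := right_nhdsWithin_Ioo_neBot hsL
  obtain ⟨t, ht, rfl⟩ := isPreconnected_Ioo.intermediate_value_Ioo
    (l₁ := 𝓝[Ioo s (s + L)] s) (l₂ := 𝓝[Ioo s (s + L)] (s + L))
    (le_principal_iff.2 self_mem_nhdsWithin) (le_principal_iff.2 self_mem_nhdsWithin)
    (f := chordAngle γ s)
    (fun t ht => (hγ.hasDerivAt_chordAngle hD
      (hγ.apply_ne_of_mem_Ioo ht)).continuousAt.continuousWithinAt)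
    ((hγ.tendsto_chordAngle_right s).mono_left (nhdsWithin_mono _ Ioo_subset_Ioi_self))
    (h2.mono_left (nhdsWithin_mono _ Ioo_subset_Iio_self)) hu
  refine ⟨toIcoMod hL 0 t, by simpa using toIcoMod_mem_Ico hL 0 t, ?_, ?_⟩
  · rw [toIcoMod, hγ.periodic.sub_zsmul_eq]
    exact hγ.apply_ne_of_mem_Ioo ht
  · have hp : Function.Periodic (chordAngle γ s) L := hγ.periodic_chordAngle_right s
    rw [toIcoMod, hp.sub_zsmul_eq]

/-- A point of the boundary is determined by the direction in which it is seen from another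
point. -/
theorem apply_eq_of_chordAngle_eq (hγ : IsC2ArcLengthParam D L γ) (hD : IsStrictlyConvexDomain D)
    {s t t' : ℝ} (ht : γ t ≠ γ s) (ht' : γ t' ≠ γ s) (h : chordAngle γ s t = chordAngle γ s t') :
    γ t = γ t' := by
  have hL := hγ.length_pos
  have hp : Function.Periodic (chordAngle γ s) L := hγ.periodic_chordAngle_right s
  have key : ∀ t, γ t ≠ γ s → ∃ r ∈ Ioo s (s + L), γ r = γ t ∧
      chordAngle γ s r = chordAngle γ s t := by
    intro t ht
    have h1 : γ (toIcoMod hL s t) = γ t := by rw [toIcoMod, hγ.periodic.sub_zsmul_eq]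
    have h2 := toIcoMod_mem_Ico hL s t
    refine ⟨toIcoMod hL s t, ⟨lt_of_le_of_ne h2.1 fun he => ht ?_, h2.2⟩, h1, ?_⟩
    · rw [← h1, ← he]
    · rw [toIcoMod, hp.sub_zsmul_eq]
  obtain ⟨r, hr, hr1, hr2⟩ := key t ht
  obtain ⟨r', hr', hr1', hr2'⟩ := key t' ht'
  rw [← hr1, ← hr1']
  congr 1
  exact (hγ.strictMonoOn_chordAngle hD s).injOn hr hr' (by rw [hr2, hr2', h])

theorem injOn_chordAngle (hγ : IsC2ArcLengthParam D L γ) (hD : IsStrictlyConvexDomain D) (s : ℝ) :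
    InjOn (chordAngle γ s) {t ∈ Ico 0 L | γ t ≠ γ s} := fun _ ht _ ht' h =>
  hγ.injOn ht.1 ht'.1 (hγ.apply_eq_of_chordAngle_eq hD ht.2 ht'.2 h)

theorem image_chordAngle (hγ : IsC2ArcLengthParam D L γ) (hD : IsStrictlyConvexDomain D) (s : ℝ) :
    chordAngle γ s '' {t ∈ Ico 0 L | γ t ≠ γ s} = Ioo 0 Real.pi := by
  apply Subset.antisymm
  · rintro _ ⟨t, ht, rfl⟩
    exact hγ.chordAngle_mem hD ht.2
  · intro u hu
    obtain ⟨t, h1, h2, h3⟩ := hγ.exists_chordAngle_eq hD s hu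
    exact ⟨t, ⟨h1, h2⟩, h3⟩

end IsC2ArcLengthParam

/-! ### The billiard map in chord coordinates and its invariant measure -/

namespace IsC2ArcLengthParam

theorem norm_chord_smul_velocity (hγ : IsC2ArcLengthParam D L γ) {s t : ℝ} :
    ‖γ t - γ s‖ * velocity γ (s, chordAngle γ s t) = γ t - γ s := by
  set w := (γ t - γ s) / deriv γ s with hw
  have h1 : γ t - γ s = w * deriv γ s := by
    rw [hw]; field_simp [hγ.deriv_ne_zero s]
  have h2 : ‖γ t - γ s‖ = ‖w‖ := (hγ.norm_chord_div s t).symm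
  rw [h2, velocity, innerNormal, chordAngle, ← hw, h1]
  have h3 := Complex.norm_mul_cos_add_sin_mul_I w
  push_cast
  conv_rhs => rw [← h3]
  ring

theorem norm_velocity (hγ : IsC2ArcLengthParam D L γ) (x : ℝ × ℝ) : ‖velocity γ x‖ = 1 := by
  have h : velocity γ x = Complex.exp (x.2 * Complex.I) * deriv γ x.1 := by
    rw [velocity, innerNormal, Complex.exp_mul_I]
    push_cast
    ring
  rw [h, norm_mul, Complex.norm_exp_ofReal_mul_I, hγ.unit_speed, one_mul]

/-- Any other boundary point on the ray would be seen from `γ s` at the same angle, hence would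
coincide with `γ t`. -/
theorem chordLength_eq (hγ : IsC2ArcLengthParam D L γ) (hD : IsStrictlyConvexDomain D) {s t : ℝ}
    (hne : γ t ≠ γ s) : chordLength D γ (s, chordAngle γ s t) = ‖γ t - γ s‖ := by
  have hv := hγ.norm_velocity (s, chordAngle γ s t)
  have hc := hγ.norm_chord_smul_velocity (s := s) (t := t)
  have hpos : 0 < ‖γ t - γ s‖ := norm_pos_iff.2 (sub_ne_zero.2 hne)
  set v := velocity γ (s, chordAngle γ s t)
  have hv0 : v ≠ 0 := by intro h; simp [h] at hv
  refine IsGreatest.csSup_eq ⟨⟨norm_nonneg _, ?_⟩, ?_⟩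
  · change γ s + (‖γ t - γ s‖ : ℂ) * v ∈ _
    rw [hc, add_sub_cancel]
    exact hγ.mem_frontier t
  · rintro r ⟨hr, hr'⟩
    rcases hr.eq_or_lt with rfl | hr
    · exact norm_nonneg _
    obtain ⟨t', -, ht'⟩ := hγ.exists_mem_Ico hr'
    change γ t' = γ s + r * v at ht'
    have hr0 : (r : ℂ) ≠ 0 := by exact_mod_cast hr.ne'
    have hne' : γ t' ≠ γ s := by
      rw [ht']
      simp [hr0, hv0]
    have h1 : chordAngle γ s t' = chordAngle γ s t := by
      rw [chordAngle, chordAngle, ht', ← hc, add_sub_cancel_left, mul_div_assoc, mul_div_assoc,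
        Complex.arg_real_mul _ hr, Complex.arg_real_mul _ hpos]
    have h2 := hγ.apply_eq_of_chordAngle_eq hD hne' hne h1
    rw [← h2, ht', add_sub_cancel_left, norm_mul, hv, mul_one, Complex.norm_real,
      Real.norm_of_nonneg hr.le]

theorem nextParam_eq (hγ : IsC2ArcLengthParam D L γ) {x : ℝ × ℝ} {t : ℝ} (ht : t ∈ Ico 0 L)
    (h : nextPoint D γ x = γ t) : nextParam D L γ x = t := by
  rw [nextParam, h]
  exact hγ.injOn.leftInvOn_invFunOn ht

/-- Reflection preserves the norm and the tangential component, and these determine the unoriented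
angle. -/
theorem angle_reflectedVelocity (hγ : IsC2ArcLengthParam D L γ) (x : ℝ × ℝ) :
    InnerProductGeometry.angle (reflectedVelocity D L γ x) (deriv γ (nextParam D L γ x)) =
      InnerProductGeometry.angle (velocity γ x) (deriv γ (nextParam D L γ x)) := by
  set t := nextParam D L γ x
  have hn : ‖innerNormal γ t‖ = 1 := by simp [innerNormal, hγ.unit_speed]
  have hin : inner ℝ (innerNormal γ t) (deriv γ t) = 0 := by
    simp [innerNormal, Complex.inner]
    ring
  have hnorm : ‖reflectedVelocity D L γ x‖ = ‖velocity γ x‖ := by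
    rw [← sq_eq_sq₀ (norm_nonneg _) (norm_nonneg _), reflectedVelocity, ← Complex.real_smul,
      norm_sub_sq_real, real_inner_smul_right, norm_smul, hn,
      real_inner_comm (innerNormal γ (nextParam D L γ x)), mul_one, Real.norm_eq_abs, sq_abs]
    ring
  have hinner : inner ℝ (reflectedVelocity D L γ x) (deriv γ t) =
      inner ℝ (velocity γ x) (deriv γ t) := by
    rw [reflectedVelocity, ← Complex.real_smul, inner_sub_left, real_inner_smul_left]
    change _ - _ * inner ℝ (innerNormal γ t) (deriv γ t) = _
    rw [hin]
    ring
  rw [InnerProductGeometry.angle, InnerProductGeometry.angle, hnorm, hinner]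

/-- The billiard map in terms of chords. -/
theorem billiardMap_chordAngle (hγ : IsC2ArcLengthParam D L γ) (hD : IsStrictlyConvexDomain D)
    {s t : ℝ} (ht : t ∈ Ico 0 L) (hne : γ t ≠ γ s) :
    billiardMap D L γ (s, chordAngle γ s t) = (t, arrivalAngle γ s t) := by
  have hc := hγ.norm_chord_smul_velocity (s := s) (t := t)
  have hpos : 0 < ‖γ t - γ s‖ := norm_pos_iff.2 (sub_ne_zero.2 hne)
  have h1 : nextParam D L γ (s, chordAngle γ s t) = t := by
    refine hγ.nextParam_eq ht ?_
    rw [nextPoint, hγ.chordLength_eq hD hne, hc, add_sub_cancel]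
  rw [billiardMap, hγ.angle_reflectedVelocity, h1]
  congr 1
  have h2 : InnerProductGeometry.angle (γ t - γ s) (deriv γ t) = arrivalAngle γ s t := by
    have h3 := Complex.angle_eq_abs_arg (sub_ne_zero.2 hne.symm) (hγ.deriv_ne_zero t)
    change _ = |chordAngle γ t s| at h3
    rw [abs_of_pos (hγ.chordAngle_mem hD hne.symm).1] at h3
    rw [arrivalAngle, ← h3, ← InnerProductGeometry.angle_neg_left, neg_sub]
  rw [← h2, ← hc, ← Complex.real_smul, InnerProductGeometry.angle_smul_left_of_pos _ _ hpos]

/-- The billiard map fixes the tangent vectors. -/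
theorem billiardMap_tangent (hγ : IsC2ArcLengthParam D L γ) (hD : IsStrictlyConvexDomain D)
    {s θ : ℝ} (hs : s ∈ Ico 0 L) (hθ : θ = 0 ∨ θ = Real.pi) :
    billiardMap D L γ (s, θ) = (s, θ) := by
  have hv : velocity γ (s, θ) = (Real.cos θ : ℝ) * deriv γ s := by
    rcases hθ with rfl | rfl <;> simp [velocity]
  have hlen : chordLength D γ (s, θ) = 0 := by
    refine IsGreatest.csSup_eq ⟨⟨le_rfl, by simpa using hγ.mem_frontier s⟩, ?_⟩
    rintro r ⟨hr, hr'⟩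
    by_contra hcon
    push Not at hcon
    obtain ⟨t, -, ht⟩ := hγ.exists_mem_Ico hr'
    change γ t = γ s + r * velocity γ (s, θ) at ht
    have hne : γ t ≠ γ s := by
      have h1 := hγ.norm_velocity (s, θ)
      have h2 : velocity γ (s, θ) ≠ 0 := by intro h; simp [h] at h1
      rw [ht]
      simp [h2, hcon.ne']
    have h3 := hγ.im_chord_pos hD hne
    rw [ht, add_sub_cancel_left, hv, ← mul_assoc,
      mul_div_cancel_right₀ _ (hγ.deriv_ne_zero s), ← Complex.ofReal_mul, Complex.ofReal_im] at h3
    exact lt_irrefl _ h3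
  have h1 : nextParam D L γ (s, θ) = s := by
    refine hγ.nextParam_eq hs ?_
    rw [nextPoint, hlen]
    simp
  rw [billiardMap, hγ.angle_reflectedVelocity, h1, hv]
  congr 1
  rcases hθ with rfl | rfl
  · simp [InnerProductGeometry.angle_self (hγ.deriv_ne_zero s)]
  · simp [InnerProductGeometry.angle_neg_self_of_nonzero (hγ.deriv_ne_zero s)]

theorem billiardMap_mem_phaseSpace (hγ : IsC2ArcLengthParam D L γ)
    (hD : IsStrictlyConvexDomain D) {x : ℝ × ℝ} (hx : x ∈ phaseSpace L) :
    billiardMap D L γ x ∈ phaseSpace L := by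
  refine ⟨?_, InnerProductGeometry.angle_nonneg _ _, InnerProductGeometry.angle_le_pi _ _⟩
  obtain ⟨s, θ⟩ := x
  obtain ⟨hs, h0, h1⟩ := hx
  by_cases hθ : θ = 0 ∨ θ = Real.pi
  · rw [hγ.billiardMap_tangent hD hs hθ]
    exact hs
  · push Not at hθ
    obtain ⟨t, ht, hne, rfl⟩ := hγ.exists_chordAngle_eq hD s
      (⟨lt_of_le_of_ne h0 hθ.1.symm, lt_of_le_of_ne h1 hθ.2⟩ : θ ∈ Ioo 0 Real.pi)
    rw [hγ.billiardMap_chordAngle hD ht hne]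
    exact ht

theorem measurableSet_chord (hγ : IsC2ArcLengthParam D L γ) (s : ℝ) :
    MeasurableSet {t ∈ Ico 0 L | γ t ≠ γ s} :=
  measurableSet_Ico.inter (hγ.continuous.measurable (measurableSet_singleton (γ s)).compl)

/-- Change of variables between the direction of a chord and its end point. -/
theorem lintegral_chordAngle (hγ : IsC2ArcLengthParam D L γ) (hD : IsStrictlyConvexDomain D)
    (s : ℝ) (F : ℝ → ℝ≥0∞) :
    ∫⁻ t in Ico 0 L, ENNReal.ofReal (chordAngleDeriv γ s t) * F (chordAngle γ s t) =
      ∫⁻ u in Ioo 0 Real.pi, F u := by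
  rw [← hγ.image_chordAngle hD s,
    lintegral_image_eq_lintegral_abs_deriv_mul (hγ.measurableSet_chord s)
      (fun t ht => (hγ.hasDerivAt_chordAngle hD ht.2).hasDerivWithinAt)
      (hγ.injOn_chordAngle hD s)]
  have hm : MeasurableSet {t | γ t ≠ γ s} :=
    hγ.continuous.measurable (measurableSet_singleton (γ s)).compl
  rw [← lintegral_inter_add_sdiff _ (Ico 0 L) hm]
  -- Where the chord degenerates, `chordAngleDeriv` is a division by zero, with value 0.
  have h0 : ∫⁻ t in Ico 0 L \ {t | γ t ≠ γ s},
      ENNReal.ofReal (chordAngleDeriv γ s t) * F (chordAngle γ s t) = 0 := by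
    rw [setLIntegral_congr_fun (g := fun _ => 0) (measurableSet_Ico.diff hm), lintegral_zero]
    intro t ht
    have : γ t = γ s := by simpa using ht.2
    simp [chordAngleDeriv, this]
  rw [h0, add_zero]
  refine setLIntegral_congr_fun (hγ.measurableSet_chord s) fun t ht => ?_
  rw [abs_of_pos (hγ.chordAngleDeriv_pos hD ht.2)]

theorem lintegral_Ioo_pi_sub (F : ℝ → ℝ≥0∞) :
    ∫⁻ u in Ioo 0 Real.pi, F (Real.pi - u) = ∫⁻ u in Ioo 0 Real.pi, F u := by
  rw [← lintegral_indicator measurableSet_Ioo, ← lintegral_indicator measurableSet_Ioo,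
    ← lintegral_sub_left_eq_self _ Real.pi]
  congr 1 with u
  simp only [indicator, mem_Ioo, sub_sub_cancel, sub_pos, sub_lt_self_iff]
  exact if_congr and_comm rfl rfl

theorem ae_chord_ne (hγ : IsC2ArcLengthParam D L γ) (s : ℝ) :
    ∀ᵐ t ∂volume.restrict (Ico 0 L), γ t ≠ γ s := by
  rw [ae_restrict_iff' measurableSet_Ico]
  have h : {t ∈ Ico 0 L | γ t = γ s}.Subsingleton := fun t ht t' ht' =>
    hγ.injOn ht.1 ht'.1 (ht.2.trans ht'.2.symm)
  refine measure_mono_null (fun t ht => ?_) (h.measure_zero volume)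
  simpa [and_assoc] using ht

/-- The billiard map preserves the measure `sin θ ds dθ`. -/
theorem lintegral_billiard (hγ : IsC2ArcLengthParam D L γ) (hD : IsStrictlyConvexDomain D)
    {f : ℝ × ℝ → ℝ≥0∞} (hf : Measurable f) :
    ∫⁻ s in Ico 0 L, ∫⁻ t in Ico 0 L, ENNReal.ofReal (chordAngleDeriv γ s t) *
        (ENNReal.ofReal (Real.sin (chordAngle γ s t)) * f (t, arrivalAngle γ s t)) =
      ∫⁻ s in Ico 0 L, ∫⁻ θ in Ioo 0 Real.pi, ENNReal.ofReal (Real.sin θ) * f (s, θ) := by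
  have hm1 := hγ.measurable_chordAngle
  have hm2 := hγ.measurable_arrivalAngle
  have hm3 := hγ.measurable_chordAngleDeriv
  -- Each chord is now run backwards, from `t` to `s`: the density is symmetric, and the arrival
  -- angle is π minus the angle of the reversed chord.
  rw [lintegral_lintegral_swap]
  · refine setLIntegral_congr_fun measurableSet_Ico fun t _ => ?_
    rw [← lintegral_Ioo_pi_sub, ← hγ.lintegral_chordAngle hD t]
    refine setLIntegral_congr_fun measurableSet_Ico fun s _ => ?_
    rw [Real.sin_pi_sub, ← mul_assoc, ← mul_assoc, mul_comm (ENNReal.ofReal (chordAngleDeriv γ s t)),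
      mul_comm (ENNReal.ofReal (chordAngleDeriv γ t s)),
      ← ENNReal.ofReal_mul (Real.sin_nonneg_of_mem_Icc (hγ.chordAngle_mem_Icc hD _ _)),
      ← ENNReal.ofReal_mul (Real.sin_nonneg_of_mem_Icc (hγ.chordAngle_mem_Icc hD _ _)),
      hγ.sin_mul_chordAngleDeriv_comm s t]
    rfl
  · refine Measurable.aemeasurable ?_
    simp only [Function.uncurry_def]
    exact hm3.ennreal_ofReal.mul ((Real.measurable_sin.comp hm1).ennreal_ofReal.mul
      (hf.comp (measurable_snd.prodMk hm2)))

end IsC2ArcLengthParam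

/-! ### The averaging operators -/

/-- The interval of the angles into which the angle `θ` can be perturbed. -/
def window (ε θ : ℝ) : Set ℝ := Ioo (truncAngle ε θ - ε) (truncAngle ε θ + ε)

/-- Averaging over the perturbations of the angle. -/
def angleOp (ε : ℝ) (f : ℝ × ℝ → ℝ≥0∞) (y : ℝ × ℝ) : ℝ≥0∞ :=
  ENNReal.ofReal (1 / (2 * ε)) * ∫⁻ u in window ε y.2, f (y.1, u)

/-- Perturbation of the angle followed by a move along the chord, on functions: the integral
is over the end points of the chords. -/
def chordOp (L : ℝ) (γ : ℝ → ℂ) (ε : ℝ) (f : ℝ × ℝ → ℝ≥0∞) (y : ℝ × ℝ) : ℝ≥0∞ :=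
  ENNReal.ofReal (1 / (2 * ε)) * ∫⁻ t in Ico 0 L, ENNReal.ofReal (chordAngleDeriv γ y.1 t) *
    (window ε y.2).indicator (fun _ => f (t, arrivalAngle γ y.1 t)) (chordAngle γ y.1 t)

theorem truncAngle_mem (hε' : ε < Real.pi / 2) (θ : ℝ) :
    truncAngle ε θ ∈ Icc ε (Real.pi - ε) :=
  ⟨le_min (le_max_right _ _) (by linarith), min_le_right _ _⟩

theorem window_subset (hε' : ε < Real.pi / 2) (θ : ℝ) :
    window ε θ ⊆ Ioo 0 Real.pi := fun u hu => by
  have h := truncAngle_mem hε' θ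
  exact ⟨by linarith [h.1, hu.1], by linarith [h.2, hu.2]⟩

theorem continuous_truncAngle : Continuous (truncAngle ε) := by
  unfold truncAngle
  fun_prop

theorem mem_window_iff_abs {θ u : ℝ} : u ∈ window ε θ ↔ |u - truncAngle ε θ| < ε := by
  rw [abs_sub_lt_iff, window, mem_Ioo]
  constructor <;> rintro ⟨h1, h2⟩ <;> constructor <;> linarith

/-- Truncation only moves the window inwards, away from an end of [0, π] that it would cross, so no
angle of (0, π) within ε of θ is lost. -/
theorem mem_window_of_abs_lt {θ u : ℝ} (hθ : θ ∈ Icc 0 Real.pi)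
    (hu : u ∈ Ioo 0 Real.pi) (h : |u - θ| < ε) : u ∈ window ε θ := by
  rw [abs_sub_lt_iff] at h
  obtain ⟨h0, h1⟩ := hθ
  obtain ⟨h2, h3⟩ := hu
  rw [window, truncAngle, mem_Ioo]
  rcases min_cases (max θ ε) (Real.pi - ε) with ⟨h4, h5⟩ | ⟨h4, h5⟩ <;>
  rcases max_cases θ ε with ⟨h6, h7⟩ | ⟨h6, h7⟩ <;> rw [h4] <;> (try rw [h6] at h5 ⊢) <;>
    constructor <;> linarith

theorem isOpen_window_rel : IsOpen {p : ℝ × ℝ | p.2 ∈ window ε p.1} := by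
  simp only [mem_window_iff_abs]
  have := continuous_truncAngle (ε := ε)
  exact isOpen_lt (by fun_prop) continuous_const

theorem measurableSet_window (ε θ : ℝ) : MeasurableSet (window ε θ) := measurableSet_Ioo

/-- The parameter will be the target state of a transition density; joint measurability of the
density rests on this. -/
theorem measurable_chordOp_param (hγ : IsC2ArcLengthParam D L γ) {Z : Type*} [MeasurableSpace Z]
    {F : Z → ℝ × ℝ → ℝ≥0∞} (hF : Measurable (Function.uncurry F)) :
    Measurable fun p : Z × (ℝ × ℝ) => chordOp L γ ε (F p.1) p.2 := by
  have hm1 := hγ.measurable_chordAngle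
  have hm2 := hγ.measurable_arrivalAngle
  have hm3 := hγ.measurable_chordAngleDeriv
  refine Measurable.const_mul (Measurable.lintegral_prod_right ?_) _
  have hpt : Measurable fun q : (Z × (ℝ × ℝ)) × ℝ => (q.1.2.1, q.2) := by fun_prop
  simp only [Function.uncurry_def]
  refine (hm3.comp hpt).ennreal_ofReal.mul ?_
  have hset : MeasurableSet {q : (Z × (ℝ × ℝ)) × ℝ | chordAngle γ q.1.2.1 q.2 ∈ window ε q.1.2.2} := by
    have h1 : Measurable fun q : (Z × (ℝ × ℝ)) × ℝ => (q.1.2.2, chordAngle γ q.1.2.1 q.2) :=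
      Measurable.prodMk (by fun_prop) (hm1.comp hpt)
    exact h1 isOpen_window_rel.measurableSet
  have hFm : Measurable fun q : (Z × (ℝ × ℝ)) × ℝ => F q.1.1 (q.2, arrivalAngle γ q.1.2.1 q.2) :=
    hF.comp (Measurable.prodMk (by fun_prop) (measurable_snd.prodMk (hm2.comp hpt)))
  exact hFm.indicator hset

theorem measurable_chordOp (hγ : IsC2ArcLengthParam D L γ) {f : ℝ × ℝ → ℝ≥0∞}
    (hf : Measurable f) : Measurable (chordOp L γ ε f) := by
  have h : Measurable fun p : Unit × (ℝ × ℝ) => chordOp L γ ε f p.2 :=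
    measurable_chordOp_param hγ (F := fun _ : Unit => f) (hf.comp measurable_snd)
  have h' : Measurable fun y : ℝ × ℝ => ((), y) := by fun_prop
  have h2 := h.comp h'
  have h3 : (fun p : Unit × (ℝ × ℝ) => chordOp L γ ε f p.2) ∘ (fun y : ℝ × ℝ => ((), y)) =
    chordOp L γ ε f := rfl
  rwa [h3] at h2

theorem measurable_chordOp_integrand (hγ : IsC2ArcLengthParam D L γ) {f : ℝ × ℝ → ℝ≥0∞}
    (hf : Measurable f) (s θ : ℝ) :
    Measurable fun t => ENNReal.ofReal (chordAngleDeriv γ s t) *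
      (window ε θ).indicator (fun _ => f (t, arrivalAngle γ s t)) (chordAngle γ s t) := by
  have hpt : Measurable fun t : ℝ => (s, t) := by fun_prop
  have hm1 := hγ.measurable_chordAngle.comp hpt
  have hm2 := hγ.measurable_arrivalAngle.comp hpt
  have hm3 := hγ.measurable_chordAngleDeriv.comp hpt
  refine hm3.ennreal_ofReal.mul ?_
  have hset : MeasurableSet {t : ℝ | chordAngle γ s t ∈ window ε θ} := hm1 measurableSet_Ioo
  exact (hf.comp (measurable_id.prodMk hm2)).indicator hset

theorem measurable_iterate_chordOp (hγ : IsC2ArcLengthParam D L γ) {f : ℝ × ℝ → ℝ≥0∞}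
    (hf : Measurable f) (n : ℕ) : Measurable ((chordOp L γ ε)^[n] f) := by
  induction n with
  | zero => exact hf
  | succ n ih =>
    rw [Function.iterate_succ_apply']
    exact measurable_chordOp hγ ih

theorem monotone_chordOp : Monotone (chordOp L γ ε) := fun f g hfg y => by
  unfold chordOp
  gcongr
  exact hfg _

theorem chordOp_const_mul {f : ℝ × ℝ → ℝ≥0∞} {c : ℝ≥0∞} (hc : c ≠ ∞) :
    chordOp L γ ε (fun y => c * f y) = fun y => c * chordOp L γ ε f y := by
  funext y
  simp only [chordOp]
  rw [mul_left_comm c, ← lintegral_const_mul' _ _ hc]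
  congr 2
  funext t
  rw [mul_left_comm c]
  congr 1
  simp only [indicator]
  split_ifs <;> simp

theorem iterate_chordOp_const_mul {f : ℝ × ℝ → ℝ≥0∞} {c : ℝ≥0∞} (hc : c ≠ ∞) (n : ℕ) :
    (chordOp L γ ε)^[n] (fun y => c * f y) = fun y => c * (chordOp L γ ε)^[n] f y := by
  induction n with
  | zero => rfl
  | succ n ih =>
    rw [Function.iterate_succ_apply', ih, chordOp_const_mul hc, Function.iterate_succ_apply']

/-- `chordOp f` vanishes at a state when `f` vanishes at almost all the states that can be
reached from it. -/
theorem chordOp_eq_zero_iff (hγ : IsC2ArcLengthParam D L γ) (hD : IsStrictlyConvexDomain D)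
    (hε : 0 < ε) (hε' : ε < Real.pi / 2) {f : ℝ × ℝ → ℝ≥0∞} (hf : Measurable f) {y : ℝ × ℝ} :
    chordOp L γ ε f y = 0 ↔ ∀ᵐ t ∂volume.restrict (Ico 0 L),
      chordAngle γ y.1 t ∈ window ε y.2 → f (t, arrivalAngle γ y.1 t) = 0 := by
  have h0 : ENNReal.ofReal (1 / (2 * ε)) ≠ 0 := by
    rw [Ne, ENNReal.ofReal_eq_zero, not_le]
    positivity
  rw [chordOp, mul_eq_zero, or_iff_right h0, lintegral_eq_zero_iff
    (measurable_chordOp_integrand hγ hf y.1 y.2)]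
  refine eventually_congr (Eventually.of_forall fun t => ?_)
  simp only [Pi.zero_apply, mul_eq_zero, indicator_apply_eq_zero]
  constructor
  · rintro (h | h) hw
    · have hne : γ t ≠ γ y.1 := by
        intro he
        have := window_subset hε' _ hw
        simp [chordAngle, he] at this
      have := hγ.chordAngleDeriv_pos hD hne
      rw [ENNReal.ofReal_eq_zero] at h
      linarith
    · exact h hw
  · exact Or.inr

/-- The vanishing of `chordOp f` depends only on the zero set of `f` in the phase space, because the
weight of every chord in the window is positive. -/
theorem chordOp_pos_of_pos (hγ : IsC2ArcLengthParam D L γ) (hD : IsStrictlyConvexDomain D)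
    (hε : 0 < ε) (hε' : ε < Real.pi / 2) {f g : ℝ × ℝ → ℝ≥0∞} (hf : Measurable f)
    (hg : Measurable g) (h : ∀ y ∈ phaseSpace L, f y ≠ 0 → g y ≠ 0) {y : ℝ × ℝ}
    (hy : chordOp L γ ε f y ≠ 0) : chordOp L γ ε g y ≠ 0 := by
  contrapose! hy
  rw [chordOp_eq_zero_iff hγ hD hε hε' hf]
  rw [chordOp_eq_zero_iff hγ hD hε hε' hg] at hy
  filter_upwards [hy, ae_restrict_mem measurableSet_Ico] with t ht htm hw
  by_contra hcon
  exact h _ ⟨htm, hγ.arrivalAngle_mem_Icc hD _ _⟩ hcon (ht hw)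

theorem iterate_chordOp_pos_of_pos (hγ : IsC2ArcLengthParam D L γ)
    (hD : IsStrictlyConvexDomain D) (hε : 0 < ε) (hε' : ε < Real.pi / 2) {f g : ℝ × ℝ → ℝ≥0∞}
    (hf : Measurable f) (hg : Measurable g) (h : ∀ y ∈ phaseSpace L, f y ≠ 0 → g y ≠ 0) (n : ℕ) :
    ∀ y ∈ phaseSpace L, (chordOp L γ ε)^[n] f y ≠ 0 → (chordOp L γ ε)^[n] g y ≠ 0 := by
  induction n with
  | zero => exact h
  | succ n ih =>
    intro y _ hy
    rw [Function.iterate_succ_apply'] at hy ⊢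
    exact chordOp_pos_of_pos hγ hD hε hε' (measurable_iterate_chordOp hγ hf n)
      (measurable_iterate_chordOp hγ hg n) ih hy

/-- This carries positivity from `s = 0` to `s = L`, so that compactness of the closed strip can be
used. -/
theorem chordOp_add_length (hγ : IsC2ArcLengthParam D L γ) (f : ℝ × ℝ → ℝ≥0∞) (s θ : ℝ) :
    chordOp L γ ε f (s + L, θ) = chordOp L γ ε f (s, θ) := by
  simp only [chordOp, hγ.periodic_chordAngle_left, hγ.periodic_arrivalAngle_left,
    hγ.periodic_chordAngleDeriv_left]

/-! ### Lower semicontinuity -/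

theorem lowerSemicontinuousAt_chordOp_integrand (hγ : IsC2ArcLengthParam D L γ)
    (hD : IsStrictlyConvexDomain D) {f : ℝ × ℝ → ℝ≥0∞} (hf : LowerSemicontinuous f)
    {y : ℝ × ℝ} {t : ℝ} (hne : γ t ≠ γ y.1) :
    LowerSemicontinuousAt (fun y : ℝ × ℝ => ENNReal.ofReal (chordAngleDeriv γ y.1 t) *
      (window ε y.2).indicator (fun _ => f (t, arrivalAngle γ y.1 t)) (chordAngle γ y.1 t)) y := by
  have hpt : ContinuousAt (fun y : ℝ × ℝ => (y.1, t)) y := by fun_prop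
  have hc1 : ContinuousAt (fun y : ℝ × ℝ => chordAngle γ y.1 t) y :=
    ContinuousAt.comp (f := fun y : ℝ × ℝ => (y.1, t))
      (hγ.continuousAt_chordAngle hD (x := (y.1, t)) hne) hpt
  have hc2 : ContinuousAt (fun y : ℝ × ℝ => arrivalAngle γ y.1 t) y :=
    ContinuousAt.comp (f := fun y : ℝ × ℝ => (y.1, t))
      (hγ.continuousAt_arrivalAngle hD (x := (y.1, t)) hne) hpt
  have hc3 : ContinuousAt (fun y : ℝ × ℝ => chordAngleDeriv γ y.1 t) y :=
    ContinuousAt.comp (f := fun y : ℝ × ℝ => (y.1, t))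
      (hγ.continuousAt_chordAngleDeriv (x := (y.1, t)) hne) hpt
  by_cases hw : chordAngle γ y.1 t ∈ window ε y.2
  · have hev : ∀ᶠ y' in 𝓝 y, chordAngle γ y'.1 t ∈ window ε y'.2 :=
      (continuousAt_snd.prodMk hc1).eventually (isOpen_window_rel.mem_nhds hw)
    have hac : ContinuousAt (fun y' : ℝ × ℝ => ENNReal.ofReal (chordAngleDeriv γ y'.1 t)) y :=
      ENNReal.continuous_ofReal.continuousAt.comp hc3
    have hb : LowerSemicontinuousAt (fun y' : ℝ × ℝ => f (t, arrivalAngle γ y'.1 t)) y :=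
      LowerSemicontinuousAt.comp (hf _) (continuousAt_const.prodMk hc2)
    have hab : LowerSemicontinuousAt (fun y' => ENNReal.ofReal (chordAngleDeriv γ y'.1 t) *
        f (t, arrivalAngle γ y'.1 t)) y := by
      rw [lowerSemicontinuousAt_iff_le_liminf] at hb ⊢
      refine le_trans ?_ ENNReal.le_liminf_mul
      rw [hac.tendsto.liminf_eq]
      gcongr
    intro r hr
    filter_upwards [hev, hab r (by simpa [hw] using hr)] with y' h1 h2
    simpa [h1] using h2
  · intro r hr
    simp [hw] at hr

/-- `chordOp` preserves lower semicontinuity. -/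
theorem lowerSemicontinuous_chordOp (hγ : IsC2ArcLengthParam D L γ)
    (hD : IsStrictlyConvexDomain D) {f : ℝ × ℝ → ℝ≥0∞}
    (hf : LowerSemicontinuous f) : LowerSemicontinuous (chordOp L γ ε f) := by
  intro y
  have h1 : LowerSemicontinuousAt (fun y : ℝ × ℝ =>
      ∫⁻ t in Ico 0 L, ENNReal.ofReal (chordAngleDeriv γ y.1 t) *
        (window ε y.2).indicator (fun _ => f (t, arrivalAngle γ y.1 t)) (chordAngle γ y.1 t)) y := by
    rw [lowerSemicontinuousAt_iff_le_liminf]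
    -- Fatou's lemma: for almost every end point the integrand is lower semicontinuous at `y`.
    refine le_trans (lintegral_mono_ae ?_) (lintegral_liminf_le fun y' => ?_)
    · filter_upwards [hγ.ae_chord_ne y.1] with t ht
      exact lowerSemicontinuousAt_iff_le_liminf.1
        (lowerSemicontinuousAt_chordOp_integrand hγ hD hf ht)
    · exact measurable_chordOp_integrand hγ hf.measurable y'.1 y'.2
  have h2 := ContinuousAt.comp_lowerSemicontinuousAt
    (ENNReal.continuous_const_mul (ENNReal.ofReal_ne_top (r := 1 / (2 * ε)))).continuousAt h1
    (fun a b hab => by gcongr)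
  exact h2

theorem lowerSemicontinuous_iterate_chordOp (hγ : IsC2ArcLengthParam D L γ)
    (hD : IsStrictlyConvexDomain D) {f : ℝ × ℝ → ℝ≥0∞} (hf : LowerSemicontinuous f) (n : ℕ) :
    LowerSemicontinuous ((chordOp L γ ε)^[n] f) := by
  induction n with
  | zero => exact hf
  | succ n ih =>
    rw [Function.iterate_succ_apply']
    exact lowerSemicontinuous_chordOp hγ hD ih

/-! ### Absorbing sets and reachability -/

theorem isOpen_setOf_exists_abs_sub_lt (F : Set ℝ) (ε : ℝ) :
    IsOpen {u : ℝ | ∃ θ ∈ F, |u - θ| < ε} := by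
  have : {u : ℝ | ∃ θ ∈ F, |u - θ| < ε} = ⋃ θ ∈ F, Metric.ball θ ε := by
    ext u
    simp [Real.dist_eq]
  rw [this]
  exact isOpen_biUnion fun θ _ => Metric.isOpen_ball

/-- If almost every point of each `ε`-ball around a point of `F` lies in `E`, then so does almost
every point of the `ε`-neighbourhood of `F`. -/
theorem ae_mem_of_exists_abs_sub_lt {F E : Set ℝ} {μ : Measure ℝ}
    (hFE : ∀ θ ∈ F, ∀ᵐ u ∂μ, |u - θ| < ε → u ∈ E) :
    ∀ᵐ u ∂μ, (∃ θ ∈ F, |u - θ| < ε) → u ∈ E := by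
  -- There are too many exceptional null sets, one for each θ. A countable dense subset of `F`
  -- suffices, since the strict inequality survives a small change of θ.
  obtain ⟨C, hCF, hCc, hCd⟩ :=
    (TopologicalSpace.IsSeparable.of_separableSpace F).exists_countable_dense_subset
  have h1 : ∀ᵐ u ∂μ, ∀ θ ∈ C, |u - θ| < ε → u ∈ E :=
    (ae_ball_iff hCc).2 fun θ hθ => hFE θ (hCF hθ)
  filter_upwards [h1] with u hu
  rintro ⟨θ, hθ, hθu⟩
  obtain ⟨θ', h3, h2⟩ := Metric.mem_closure_iff.1 (hCd hθ) (ε - |u - θ|) (by linarith)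
  refine hu θ' h3 ?_
  rw [Real.dist_eq] at h2
  have := abs_sub_le u θ θ'
  linarith

theorem indicator_one_mono {α : Type*} {S S' : Set α} {a : α} (h : a ∈ S → a ∈ S') :
    S.indicator (1 : α → ℝ≥0∞) a ≤ S'.indicator 1 a := by
  by_cases h1 : a ∈ S
  · simp [h1, h h1]
  · simp [h1]

theorem exists_mem_of_ae_restrict {A I : Set ℝ} {p : ℝ → Prop} (hI : IsOpen I)
    (hne : I.Nonempty) (hIA : I ⊆ A) (h : ∀ᵐ x ∂volume.restrict A, p x) : ∃ x ∈ I, p x := by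
  have h1 : ∀ᵐ x ∂volume.restrict I, p x := ae_restrict_of_ae_restrict_of_subset hIA h
  by_contra! hcon
  rw [ae_restrict_iff' hI.measurableSet] at h1
  exact (hI.measure_pos volume hne).ne'
    (measure_mono_null (fun x hx => by simpa using ⟨hx, hcon x hx⟩) h1)

/-- A set of angles whose `ε`-neighbourhood is not larger in measure is conull. -/
theorem ae_mem_of_thickening {F E : Set ℝ} (hε : 0 < ε) (hF : F ⊆ Icc 0 Real.pi)
    (hne : F.Nonempty)
    (hUE : ∀ᵐ u ∂volume.restrict (Ioo 0 Real.pi), (∃ θ ∈ F, |u - θ| < ε) → u ∈ E)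
    (hle : ∫⁻ u in Ioo 0 Real.pi, ENNReal.ofReal (Real.sin u) * E.indicator 1 u ≤
      ∫⁻ u in Ioo 0 Real.pi, ENNReal.ofReal (Real.sin u) * F.indicator 1 u) :
    (∀ᵐ u ∂volume.restrict (Ioo 0 Real.pi), u ∈ F) ∧
      ∀ᵐ u ∂volume.restrict (Ioo 0 Real.pi), u ∈ E := by
  set U : Set ℝ := {u | ∃ θ ∈ F, |u - θ| < ε} with hU
  have hUo : IsOpen U := isOpen_setOf_exists_abs_sub_lt F ε
  have hFU : F ⊆ U := fun θ hθ => ⟨θ, hθ, by simpa using hε⟩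
  -- `F ⊆ U`, and almost all of `U` lies in `E`, whose weight is at most the finite weight of `F`.
  -- So `U` and `F` have equal weight, and the weight sin is positive on (0, π).
  have hUF : ∀ᵐ u ∂volume.restrict (Ioo 0 Real.pi), u ∈ U → u ∈ F := by
    have hfin : ∫⁻ u in Ioo 0 Real.pi, ENNReal.ofReal (Real.sin u) * F.indicator 1 u ≠ ∞ := by
      refine ne_top_of_le_ne_top (b := ∫⁻ u in Ioo 0 Real.pi, 1) (by simp) ?_
      refine lintegral_mono fun u => ?_
      calc ENNReal.ofReal (Real.sin u) * F.indicator 1 u ≤ 1 * 1 := by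
            gcongr
            · exact ENNReal.ofReal_le_one.2 (Real.sin_le_one u)
            · simpa using indicator_one_mono (S := F) (S' := univ) (a := u) fun _ => mem_univ u
        _ = 1 := one_mul 1
    have hsm : Measurable fun u => ENNReal.ofReal (Real.sin u) := by fun_prop
    have h1 : ∀ᵐ u ∂volume.restrict (Ioo 0 Real.pi),
        ENNReal.ofReal (Real.sin u) * F.indicator 1 u ≤
          ENNReal.ofReal (Real.sin u) * U.indicator 1 u := Eventually.of_forall fun u =>
      mul_le_mul_right (indicator_one_mono fun h => hFU h) _
    have h2 := ae_eq_of_ae_le_of_lintegral_le h1 hfin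
      (hsm.mul (measurable_one.indicator hUo.measurableSet)).aemeasurable
      (le_trans (lintegral_mono_ae (by
        filter_upwards [hUE] with u hu
        exact mul_le_mul_right (indicator_one_mono hu) _)) hle)
    filter_upwards [h2, ae_restrict_mem measurableSet_Ioo] with u h3 hu hUu
    by_contra hcon
    have hs := Real.sin_pos_of_pos_of_lt_pi hu.1 hu.2
    simp [hUu, hcon] at h3
    linarith
  -- `U` is open and relatively closed: near a limit point of `U` there is an open piece of `U`,
  -- hence a point of `F` at distance less than ε.
  have hall : Ioo 0 Real.pi ⊆ U := by
    refine isPreconnected_Ioo.subset_of_closure_inter_subset hUo ?_ ?_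
    · obtain ⟨θ, hθ⟩ := hne
      have h0 : θ ∈ closure (Ioo 0 Real.pi) := by
        rw [closure_Ioo Real.pi_pos.ne]
        exact hF hθ
      obtain ⟨u, hu, hu'⟩ := Metric.mem_closure_iff.1 h0 ε hε
      exact ⟨u, hu, θ, hθ, by rwa [dist_comm, Real.dist_eq] at hu'⟩
    · rintro p ⟨hp, hp0⟩
      have ho : IsOpen (Metric.ball p ε ∩ Ioo 0 Real.pi) := Metric.isOpen_ball.inter isOpen_Ioo
      have hn : (Metric.ball p ε ∩ Ioo 0 Real.pi ∩ U).Nonempty :=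
        mem_closure_iff.1 hp _ ho ⟨Metric.mem_ball_self hε, hp0⟩
      obtain ⟨θ, ⟨⟨hθ1, -⟩, hθU⟩, hθ2⟩ := exists_mem_of_ae_restrict (ho.inter hUo) hn
        (fun u hu => hu.1.2) hUF
      exact ⟨θ, hθ2 hθU, by rwa [Metric.mem_ball, dist_comm, Real.dist_eq] at hθ1⟩
  constructor
  · filter_upwards [hUF, ae_restrict_mem measurableSet_Ioo] with u h hu using h (hall hu)
  · filter_upwards [hUE, ae_restrict_mem measurableSet_Ioo] with u h hu using h (hall hu)

/-- The Jacobian of the change of variables is positive off a null set, so null sets correspond. -/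
theorem ae_iff_ae_chordAngle (hγ : IsC2ArcLengthParam D L γ) (hD : IsStrictlyConvexDomain D)
    (s : ℝ) {S : Set ℝ} (hS : MeasurableSet S) :
    (∀ᵐ u ∂volume.restrict (Ioo 0 Real.pi), u ∈ S) ↔
      ∀ᵐ t ∂volume.restrict (Ico 0 L), chordAngle γ s t ∈ S := by
  have hpt : Measurable fun t : ℝ => (s, t) := by fun_prop
  have hi : Measurable (Sᶜ.indicator (1 : ℝ → ℝ≥0∞)) := measurable_one.indicator hS.compl
  have hm : Measurable fun t => ENNReal.ofReal (chordAngleDeriv γ s t) *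
      Sᶜ.indicator 1 (chordAngle γ s t) :=
    (hγ.measurable_chordAngleDeriv.comp hpt).ennreal_ofReal.mul
      (hi.comp (hγ.measurable_chordAngle.comp hpt))
  have h := hγ.lintegral_chordAngle hD s (Sᶜ.indicator 1)
  have h1 : (∀ᵐ u ∂volume.restrict (Ioo 0 Real.pi), u ∈ S) ↔
      ∫⁻ u in Ioo 0 Real.pi, Sᶜ.indicator 1 u = 0 := by
    rw [lintegral_eq_zero_iff hi]
    exact eventually_congr (Eventually.of_forall fun u => by simp)
  rw [h1, ← h, lintegral_eq_zero_iff hm]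
  refine eventually_congr ?_
  filter_upwards [hγ.ae_chord_ne s] with t ht
  have := hγ.chordAngleDeriv_pos hD ht
  simp [this.not_ge]

/-- A non-empty measurable set of states which is almost surely not left is conull. -/
theorem ae_mem_of_absorbing (hγ : IsC2ArcLengthParam D L γ) (hD : IsStrictlyConvexDomain D)
    (hε : 0 < ε) (hε' : ε < Real.pi / 2) {C : Set (ℝ × ℝ)} (hCm : MeasurableSet C)
    (hC : C ⊆ phaseSpace L) (hne : C.Nonempty)
    (habs : ∀ y ∈ C, ∀ᵐ t ∂volume.restrict (Ico 0 L),
      chordAngle γ y.1 t ∈ window ε y.2 → (t, arrivalAngle γ y.1 t) ∈ C) :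
    ∀ᵐ s ∂volume.restrict (Ico 0 L), ∀ᵐ θ ∂volume.restrict (Ioo 0 Real.pi), (s, θ) ∈ C := by
  set F : ℝ → Set ℝ := fun s => {θ | (s, θ) ∈ C} with hF
  set S : ℝ → Set ℝ := fun s => {t ∈ Ico 0 L | γ t ≠ γ s} ∩ {t | (t, arrivalAngle γ s t) ∈ C}
    with hS
  set E : ℝ → Set ℝ := fun s => chordAngle γ s '' S s with hE
  have hpt : ∀ s : ℝ, Measurable fun t : ℝ => (s, t) := fun s => by fun_prop
  have hSm : ∀ s, MeasurableSet (S s) := fun s => (hγ.measurableSet_chord s).inter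
    ((measurable_id.prodMk (hγ.measurable_arrivalAngle.comp (hpt s))) hCm)
  have hEm : ∀ s, MeasurableSet (E s) := fun s =>
    (hSm s).image_of_measurable_injOn (hγ.measurable_chordAngle.comp (hpt s))
      ((hγ.injOn_chordAngle hD s).mono inter_subset_left)
  have hEiff : ∀ s, ∀ t ∈ {t ∈ Ico 0 L | γ t ≠ γ s},
      (chordAngle γ s t ∈ E s ↔ (t, arrivalAngle γ s t) ∈ C) := by
    intro s t ht
    constructor
    · rintro ⟨t', ht', he⟩
      rw [← hγ.injOn_chordAngle hD s ht'.1 ht he]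
      exact ht'.2
    · exact fun h => ⟨t, ⟨ht, h⟩, rfl⟩
  have hchord : ∀ s, ∀ᵐ t ∂volume.restrict (Ico 0 L), t ∈ {t ∈ Ico 0 L | γ t ≠ γ s} := by
    intro s
    filter_upwards [hγ.ae_chord_ne s, ae_restrict_mem measurableSet_Ico] with t h1 h2
    exact ⟨h2, h1⟩
  -- `E s` consists of the angles whose chord from `γ s` lands in `C`; absorption puts almost all of
  -- the ε-thickening of `F s` into it.
  have hUE : ∀ s, ∀ᵐ u ∂volume.restrict (Ioo 0 Real.pi), (∃ θ ∈ F s, |u - θ| < ε) → u ∈ E s := by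
    intro s
    refine ae_mem_of_exists_abs_sub_lt fun θ hθ => ?_
    have hms : MeasurableSet {u | u ∈ window ε θ → u ∈ E s} := by
      have : {u | u ∈ window ε θ → u ∈ E s} = (window ε θ)ᶜ ∪ E s := by
        ext u; simp [imp_iff_not_or]
      rw [this]
      exact measurableSet_Ioo.compl.union (hEm s)
    have h1 : ∀ᵐ u ∂volume.restrict (Ioo 0 Real.pi), u ∈ {u | u ∈ window ε θ → u ∈ E s} := by
      rw [ae_iff_ae_chordAngle hγ hD s hms]
      filter_upwards [habs _ hθ, hchord s] with t h1 h2 h3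
      exact (hEiff s t h2).2 (h1 h3)
    filter_upwards [h1, ae_restrict_mem measurableSet_Ioo] with u h2 h3 h4
    exact h2 (mem_window_of_abs_lt (hC hθ).2 h3 h4)
  set v : ℝ → ℝ≥0∞ := fun s =>
    ∫⁻ u in Ioo 0 Real.pi, ENNReal.ofReal (Real.sin u) * (F s).indicator 1 u with hv
  set w : ℝ → ℝ≥0∞ := fun s =>
    ∫⁻ u in Ioo 0 Real.pi, ENNReal.ofReal (Real.sin u) * (E s).indicator 1 u with hw
  have hCi : Measurable (C.indicator (1 : ℝ × ℝ → ℝ≥0∞)) := measurable_one.indicator hCm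
  have hw' : w = fun s => ∫⁻ t in Ico 0 L, ENNReal.ofReal (chordAngleDeriv γ s t) *
      (ENNReal.ofReal (Real.sin (chordAngle γ s t)) *
        C.indicator 1 (t, arrivalAngle γ s t)) := by
    funext s
    simp only [hw]
    rw [← hγ.lintegral_chordAngle hD s]
    refine lintegral_congr_ae ?_
    filter_upwards [hchord s] with t ht
    have : (E s).indicator (1 : ℝ → ℝ≥0∞) (chordAngle γ s t) =
        C.indicator 1 (t, arrivalAngle γ s t) := by
      by_cases h : (t, arrivalAngle γ s t) ∈ C
      · simp [h, (hEiff s t ht).2 h]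
      · simp [h, mt (hEiff s t ht).1 h]
    rw [this]
  have hwm : Measurable w := by
    rw [hw']
    refine Measurable.lintegral_prod_right ?_
    simp only [Function.uncurry_def]
    exact hγ.measurable_chordAngleDeriv.ennreal_ofReal.mul
      ((Real.measurable_sin.comp hγ.measurable_chordAngle).ennreal_ofReal.mul
        (hCi.comp (measurable_snd.prodMk hγ.measurable_arrivalAngle)))
  -- Invariance: the two sides are the measures of T⁻¹C and of C. With `v ≤ w` this forces `v = w`
  -- almost everywhere.
  have hwv : ∫⁻ s in Ico 0 L, w s = ∫⁻ s in Ico 0 L, v s := by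
    rw [hw', hγ.lintegral_billiard hD hCi]
    rfl
  have hv1 : ∀ s, v s ≤ ENNReal.ofReal Real.pi := by
    intro s
    refine le_trans (lintegral_mono (g := fun _ => 1) fun u => ?_) (by simp)
    calc ENNReal.ofReal (Real.sin u) * (F s).indicator 1 u ≤ 1 * 1 := by
          gcongr
          · exact ENNReal.ofReal_le_one.2 (Real.sin_le_one u)
          · simpa using indicator_one_mono (S := F s) (S' := univ) (a := u) fun _ => mem_univ u
      _ = 1 := one_mul 1
  have hvfin : ∫⁻ s in Ico 0 L, v s ≠ ∞ := by
    refine ne_top_of_le_ne_top ?_ (lintegral_mono hv1)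
    simp [ENNReal.mul_eq_top]
  have hvw : ∀ s, v s ≤ w s := by
    intro s
    refine lintegral_mono_ae ?_
    filter_upwards [hUE s] with u hu
    exact mul_le_mul_right (indicator_one_mono fun h => hu ⟨u, h, by simpa using hε⟩) _
  have hae : ∀ᵐ s ∂volume.restrict (Ico 0 L), (F s).Nonempty →
      (∀ᵐ u ∂volume.restrict (Ioo 0 Real.pi), u ∈ F s) ∧
        ∀ᵐ u ∂volume.restrict (Ioo 0 Real.pi), u ∈ E s := by
    have h1 := ae_eq_of_ae_le_of_lintegral_le (Eventually.of_forall hvw) hvfin hwm.aemeasurable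
      hwv.le
    filter_upwards [h1] with s hs hn
    exact ae_mem_of_thickening hε (fun θ hθ => (hC hθ).2) hn (hUE s) hs.ge
  -- A state of `C` sends a positive measure of chords into `C`, so some nonempty section avoids the
  -- exceptional set of `hae`.
  obtain ⟨t, htn, htE⟩ : ∃ t, (F t).Nonempty ∧
      ((F t).Nonempty → (∀ᵐ u ∂volume.restrict (Ioo 0 Real.pi), u ∈ F t) ∧
        ∀ᵐ u ∂volume.restrict (Ioo 0 Real.pi), u ∈ E t) := by
    by_contra hcon
    replace hcon := not_exists.1 hcon
    obtain ⟨y, hy⟩ := hne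
    have h1 : ∀ᵐ t ∂volume.restrict (Ico 0 L), chordAngle γ y.1 t ∈ (window ε y.2)ᶜ := by
      filter_upwards [habs y hy, hae] with t h2 h3 h4
      exact hcon t ⟨⟨_, h2 h4⟩, h3⟩
    replace h1 := (ae_iff_ae_chordAngle hγ hD _ measurableSet_Ioo.compl).2 h1
    obtain ⟨u, hu, hu'⟩ := exists_mem_of_ae_restrict isOpen_Ioo
      (nonempty_Ioo.2 (by linarith)) (window_subset hε' y.2) h1
    exact hu' hu
  -- From the full set `E t` almost every boundary point is reached inside `C`, so almost every
  -- section is nonempty, hence full.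
  have h1 := (ae_iff_ae_chordAngle hγ hD t (hEm t)).1 (htE htn).2
  filter_upwards [h1, hchord t, hae] with s h2 h3 h4
  exact (h4 ⟨_, (hEiff t s h3).1 h2⟩).1

/-- Every open set which meets the interior of the phase space can be reached from every state. -/
theorem exists_iterate_chordOp_ne_zero (hγ : IsC2ArcLengthParam D L γ)
    (hD : IsStrictlyConvexDomain D) (hε : 0 < ε) (hε' : ε < Real.pi / 2) {V : Set (ℝ × ℝ)}
    (hV : IsOpen V) {z : ℝ × ℝ} (hz : z ∈ V) (hz' : z ∈ Ioo 0 L ×ˢ Ioo 0 Real.pi)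
    {y : ℝ × ℝ} (hy : y ∈ phaseSpace L) : ∃ n, (chordOp L γ ε)^[n] (V.indicator 1) y ≠ 0 := by
  by_contra! hcon
  have hm : ∀ n, Measurable ((chordOp L γ ε)^[n] (V.indicator 1)) := fun n =>
    measurable_iterate_chordOp hγ (measurable_one.indicator hV.measurableSet) n
  -- The states from which `V` is never charged; shifting `n` by one shows that this set is
  -- absorbing, while the case `n = 0` keeps it disjoint from `V`.
  set C : Set (ℝ × ℝ) := phaseSpace L ∩ ⋂ n, {y | (chordOp L γ ε)^[n] (V.indicator 1) y = 0}
    with hC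
  have hCm : MeasurableSet C := (measurableSet_Ico.prod measurableSet_Icc).inter
    (MeasurableSet.iInter fun n => hm n (measurableSet_singleton 0))
  have h := ae_mem_of_absorbing hγ hD hε hε' hCm inter_subset_left
    ⟨y, hy, by simpa using hcon⟩ ?_
  · obtain ⟨I, J, hI, hJ, h1, h2, hIJ⟩ := isOpen_prod_iff.1
      (hV.inter (isOpen_Ioo.prod isOpen_Ioo)) z.1 z.2 ⟨hz, hz'⟩
    have hI' : I ⊆ Ioo 0 L := fun s hs => (hIJ (mk_mem_prod hs h2)).2.1
    have hJ' : J ⊆ Ioo 0 Real.pi := fun s hs => (hIJ (mk_mem_prod h1 hs)).2.2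
    obtain ⟨s, hs, hs'⟩ := exists_mem_of_ae_restrict hI ⟨_, h1⟩
      (hI'.trans Ioo_subset_Ico_self) h
    obtain ⟨θ, hθ, hθ'⟩ := exists_mem_of_ae_restrict hJ ⟨_, h2⟩ hJ' hs'
    have h3 := mem_iInter.1 hθ'.2 0
    simp [(hIJ (mk_mem_prod hs hθ)).1] at h3
  · rintro x ⟨-, hx⟩
    have h1 : ∀ n, ∀ᵐ t ∂volume.restrict (Ico 0 L), chordAngle γ x.1 t ∈ window ε x.2 →
        (chordOp L γ ε)^[n] (V.indicator 1) (t, arrivalAngle γ x.1 t) = 0 := by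
      intro n
      rw [← chordOp_eq_zero_iff hγ hD hε hε' (hm n), ← Function.iterate_succ_apply' (chordOp L γ ε)]
      exact mem_iInter.1 hx (n + 1)
    filter_upwards [ae_all_iff.2 h1, ae_restrict_mem measurableSet_Ico] with t h2 h3 h4
    exact ⟨⟨h3, hγ.arrivalAngle_mem_Icc hD _ _⟩, mem_iInter.2 fun n => h2 n h4⟩

/-! ### Local minorization, short chords and the Doeblin condition -/

theorem IsC2ArcLengthParam.tendsto_arrivalAngle (hγ : IsC2ArcLengthParam D L γ)
    (hD : IsStrictlyConvexDomain D) (s : ℝ) :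
    Tendsto (arrivalAngle γ s) (𝓝[>] s) (𝓝 0) := by
  have hL := hγ.length_pos
  have hd : Tendsto (deriv γ) (𝓝[>] s) (𝓝 (deriv γ s)) :=
    hγ.continuous_deriv.continuousAt.tendsto.mono_left nhdsWithin_le_nhds
  have h1 := ((hγ.tendsto_slope s).mono_left (nhdsGT_le_nhdsNE s)).div hd (hγ.deriv_ne_zero s)
  rw [div_self (hγ.deriv_ne_zero s)] at h1
  have h2 := ((Complex.continuousAt_arg Complex.one_mem_slitPlane).tendsto.comp h1).neg
  rw [Complex.arg_one, neg_zero] at h2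
  refine h2.congr' ?_
  filter_upwards [self_mem_nhdsWithin,
    mem_nhdsWithin_of_mem_nhds (Iio_mem_nhds (lt_add_of_pos_right s hL))] with t ht ht2
  have ht : 0 < t - s := sub_pos.2 ht
  have hne : γ t ≠ γ s := hγ.apply_ne_of_mem_Ioo ⟨by linarith, ht2⟩
  have him := hγ.im_chord_pos hD hne.symm
  have h4 := Complex.arg_neg_eq_arg_sub_pi_of_im_pos him
  simp only [Function.comp, arrivalAngle, chordAngle, Pi.div_apply]
  have h5 : (γ t - γ s) / ((t - s : ℝ) : ℂ) / deriv γ t =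
      ((t - s)⁻¹ : ℝ) * (-((γ s - γ t) / deriv γ t)) := by
    push_cast
    rw [div_right_comm, ← neg_div, neg_sub, div_eq_inv_mul]
  rw [h5, Complex.arg_real_mul _ (inv_pos.2 ht), h4]
  ring

theorem lintegral_phaseSpace {f : ℝ × ℝ → ℝ≥0∞} (hf : Measurable f) :
    ∫⁻ z in phaseSpace L, f z =
      ∫⁻ s in Ico 0 L, ∫⁻ θ in Ioo 0 Real.pi, f (s, θ) := by
  rw [phaseSpace, Measure.volume_eq_prod, ← Measure.prod_restrict,
    ← restrict_Ioo_eq_restrict_Icc, lintegral_prod _ hf.aemeasurable]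

/-- Two steps of the process charge a neighbourhood of a given state, uniformly with respect to
the starting point in some open set. -/
theorem exists_local_minorization (hγ : IsC2ArcLengthParam D L γ) (hD : IsStrictlyConvexDomain D)
    (hε : 0 < ε) {z : ℝ × ℝ} (hz : z.2 ∈ Icc 0 Real.pi) :
    ∃ W ∈ 𝓝 z, ∃ V : Set (ℝ × ℝ), IsOpen V ∧ (V ∩ Ioo 0 L ×ˢ Ioo 0 Real.pi).Nonempty ∧
      ∃ c : ℝ≥0, 0 < c ∧ ∀ A ⊆ phaseSpace L, MeasurableSet A → ∀ y ∈ V,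
        c * volume (A ∩ W) ≤ chordOp L γ ε (angleOp ε (A.indicator 1)) y := by
  -- An arrival angle at `γ z.1` from which `z.2` is within reach. The excluded value would make the
  -- chord start at parameter 0, outside the open interval `Ioo 0 L`.
  obtain ⟨θ, hθ, hθ0⟩ : ∃ θ ∈ Ioo (max 0 (z.2 - ε)) (min Real.pi (z.2 + ε)),
      θ ≠ Real.pi - chordAngle γ z.1 0 := by
    refine (Ioo_infinite ?_).nontrivial.exists_ne _
    have := hz.1
    have := hz.2
    have := Real.pi_pos
    refine max_lt (lt_min ?_ ?_) (lt_min ?_ ?_) <;> linarith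
  have hθ1 : θ ∈ Ioo 0 Real.pi :=
    ⟨(le_max_left _ _).trans_lt hθ.1, hθ.2.trans_le (min_le_left _ _)⟩
  have hθ2 : z.2 - ε < θ := (le_max_right _ _).trans_lt hθ.1
  have hθ3 : θ < z.2 + ε := hθ.2.trans_le (min_le_right _ _)
  obtain ⟨s, hs, hne, hsθ⟩ := hγ.exists_chordAngle_eq hD z.1 (u := Real.pi - θ)
    ⟨by linarith [hθ1.2], by linarith [hθ1.1]⟩
  have hs0 : s ≠ 0 := by
    rintro rfl
    exact hθ0 (by linarith)
  have hβ : arrivalAngle γ s z.1 = θ := by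
    rw [arrivalAngle, hsθ]; ring
  set u := chordAngle γ s z.1 with hu
  have hu1 : u ∈ Ioo 0 Real.pi := hγ.chordAngle_mem hD hne.symm
  set r := chordAngleDeriv γ s z.1 with hr
  have hr0 : 0 < r := hγ.chordAngleDeriv_pos hD hne.symm
  -- the conditions below hold near the chord from `γ s` to `γ z.1`
  have hpt : ContinuousAt (fun p : (ℝ × ℝ) × (ℝ × ℝ) => (p.1.1, p.2.1)) ((s, u), z) := by
    fun_prop
  have hc1 : ContinuousAt (fun p : (ℝ × ℝ) × (ℝ × ℝ) => chordAngle γ p.1.1 p.2.1) ((s, u), z) :=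
    ContinuousAt.comp (g := fun x : ℝ × ℝ => chordAngle γ x.1 x.2)
      (f := fun p : (ℝ × ℝ) × (ℝ × ℝ) => (p.1.1, p.2.1))
      (hγ.continuousAt_chordAngle hD (x := (s, z.1)) hne.symm) hpt
  have hc2 : ContinuousAt (fun p : (ℝ × ℝ) × (ℝ × ℝ) => arrivalAngle γ p.1.1 p.2.1)
      ((s, u), z) :=
    ContinuousAt.comp (g := fun x : ℝ × ℝ => arrivalAngle γ x.1 x.2)
      (f := fun p : (ℝ × ℝ) × (ℝ × ℝ) => (p.1.1, p.2.1))
      (hγ.continuousAt_arrivalAngle hD (x := (s, z.1)) hne.symm) hpt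
  have hc3 : ContinuousAt (fun p : (ℝ × ℝ) × (ℝ × ℝ) => chordAngleDeriv γ p.1.1 p.2.1)
      ((s, u), z) :=
    ContinuousAt.comp (g := fun x : ℝ × ℝ => chordAngleDeriv γ x.1 x.2)
      (f := fun p : (ℝ × ℝ) × (ℝ × ℝ) => (p.1.1, p.2.1))
      (hγ.continuousAt_chordAngleDeriv (x := (s, z.1)) hne.symm) hpt
  have hev1 : ∀ᶠ p in 𝓝 (((s, u), z) : (ℝ × ℝ) × (ℝ × ℝ)), r / 2 < chordAngleDeriv γ p.1.1 p.2.1 :=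
    hc3.eventually (lt_mem_nhds (half_lt_self hr0))
  have hev2 : ∀ᶠ p in 𝓝 (((s, u), z) : (ℝ × ℝ) × (ℝ × ℝ)),
      chordAngle γ p.1.1 p.2.1 ∈ window ε p.1.2 := by
    have h1 : ContinuousAt (fun p : (ℝ × ℝ) × (ℝ × ℝ) => (p.1.2, chordAngle γ p.1.1 p.2.1))
      ((s, u), z) := ContinuousAt.prodMk (by fun_prop) hc1
    exact h1.eventually (isOpen_window_rel.mem_nhds
      (mem_window_of_abs_lt (Ioo_subset_Icc_self hu1) hu1 (by simpa [hu] using hε)))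
  have hev3 : ∀ᶠ p in 𝓝 (((s, u), z) : (ℝ × ℝ) × (ℝ × ℝ)),
      |p.2.2 - arrivalAngle γ p.1.1 p.2.1| < ε := by
    have h1 : ContinuousAt (fun p : (ℝ × ℝ) × (ℝ × ℝ) => |p.2.2 - arrivalAngle γ p.1.1 p.2.1|)
      ((s, u), z) := (ContinuousAt.sub (by fun_prop) hc2).abs
    refine h1.eventually (gt_mem_nhds ?_)
    simp only [hβ, abs_sub_lt_iff]
    constructor <;> linarith
  obtain ⟨V', hV', W', hW', hVW⟩ := mem_nhds_prod_iff.1 (hev1.and (hev2.and hev3))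
  obtain ⟨V, hVV', hVo, hVs⟩ := mem_nhds_iff.1 hV'
  obtain ⟨W, hWW', hWo, hWz⟩ := mem_nhds_iff.1 hW'
  refine ⟨W, hWo.mem_nhds hWz, V, hVo, ⟨(s, u), hVs,
    ⟨⟨lt_of_le_of_ne hs.1 hs0.symm, hs.2⟩, hu1⟩⟩,
    -- Two uniform angular densities, and half the Jacobian of the chosen chord as a local lower
    -- bound.
    (1 / (2 * ε)).toNNReal * (r / 2).toNNReal * (1 / (2 * ε)).toNNReal, by positivity, ?_⟩
  intro A hA hAm y hy
  have hmem : ∀ t v, (t, v) ∈ W → r / 2 < chordAngleDeriv γ y.1 t ∧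
      chordAngle γ y.1 t ∈ window ε y.2 ∧ |v - arrivalAngle γ y.1 t| < ε := fun t v htv =>
    hVW (mk_mem_prod (hVV' hy) (hWW' htv))
  have hvol : volume (A ∩ W) =
      ∫⁻ t in Ico 0 L, ∫⁻ v in Ioo 0 Real.pi, (A ∩ W).indicator 1 (t, v) := by
    rw [← lintegral_phaseSpace (measurable_one.indicator (hAm.inter hWo.measurableSet)),
      lintegral_indicator_one (hAm.inter hWo.measurableSet),
      Measure.restrict_apply (hAm.inter hWo.measurableSet),
      inter_eq_left.2 (inter_subset_left.trans hA)]
  rw [hvol, chordOp, ENNReal.coe_mul, ENNReal.coe_mul, mul_assoc, mul_assoc,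
    ← lintegral_const_mul' _ _ ENNReal.coe_ne_top, ← lintegral_const_mul' _ _ ENNReal.coe_ne_top]
  change ENNReal.ofReal (1 / (2 * ε)) * _ ≤ _
  refine mul_le_mul_right (lintegral_mono fun t => ?_) _
  by_cases ht : ∃ v, (t, v) ∈ W
  · obtain ⟨v, hv⟩ := ht
    obtain ⟨h1, h2, -⟩ := hmem t v hv
    rw [indicator_of_mem h2]
    refine mul_le_mul' (ENNReal.ofReal_le_ofReal h1.le) ?_
    rw [angleOp]
    change ENNReal.ofReal (1 / (2 * ε)) * _ ≤ _
    refine mul_le_mul_right ?_ _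
    rw [← lintegral_indicator measurableSet_Ioo, ← lintegral_indicator (measurableSet_window _ _)]
    refine lintegral_mono fun w => ?_
    by_cases hw : w ∈ Ioo 0 Real.pi ∧ (t, w) ∈ A ∩ W
    · have h3 : w ∈ window ε (arrivalAngle γ y.1 t) :=
        mem_window_of_abs_lt (hγ.arrivalAngle_mem_Icc hD _ _) hw.1 (hmem t w hw.2.2).2.2
      change _ ≤ (window ε (arrivalAngle γ y.1 t)).indicator _ w
      rw [indicator_of_mem h3, indicator_of_mem hw.1, indicator_of_mem hw.2,
        indicator_of_mem hw.2.1]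
    · have : (Ioo 0 Real.pi).indicator (fun v => (A ∩ W).indicator (1 : ℝ × ℝ → ℝ≥0∞) (t, v)) w
          = 0 := by
        rw [indicator_apply_eq_zero]
        intro h
        exact indicator_of_notMem (fun h' => hw ⟨h, h'⟩) _
      rw [this]
      exact zero_le
  · push Not at ht
    have : ∀ v, (A ∩ W).indicator (1 : ℝ × ℝ → ℝ≥0∞) (t, v) = 0 := fun v =>
      indicator_of_notMem (fun h => ht v h.2) _
    simp [this]

/-- Near a tangent vector the process can stay near it. -/
theorem chordOp_box_ne_zero (hγ : IsC2ArcLengthParam D L γ) (hD : IsStrictlyConvexDomain D)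
    (hε : 0 < ε) (hε' : ε < Real.pi / 2) {a b δ : ℝ} (ha : 0 ≤ a) (hb : b ≤ L)
    (hδε : δ ≤ ε) {y : ℝ × ℝ} (hy : y ∈ Ioo a b ×ˢ Ioo (-δ) δ) :
    chordOp L γ ε ((Ioo a b ×ˢ Ioo (-δ) δ).indicator 1) y ≠ 0 := by
  obtain ⟨⟨hy1, hy2⟩, hy3, hy4⟩ := hy
  have hδ : 0 < δ := by linarith
  rw [Ne, chordOp_eq_zero_iff hγ hD hε hε'
    (measurable_one.indicator (measurableSet_Ioo.prod measurableSet_Ioo))]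
  intro h
  -- Below δ ≤ ε the truncated angle is ε, so the window reaches down to 0 and contains all
  -- sufficiently short forward chords.
  have hwin : window ε y.2 = Ioo 0 (2 * ε) := by
    rw [window, truncAngle, max_eq_right (by linarith), min_eq_left (by linarith)]
    congr 1 <;> ring
  have h1 : ∀ᶠ t in 𝓝[>] y.1, chordAngle γ y.1 t < 2 * ε :=
    (hγ.tendsto_chordAngle_right y.1).eventually (gt_mem_nhds (by linarith))
  have h2 : ∀ᶠ t in 𝓝[>] y.1, arrivalAngle γ y.1 t < δ :=
    (hγ.tendsto_arrivalAngle hD y.1).eventually (gt_mem_nhds hδ)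
  have h3 : ∀ᶠ t in 𝓝[>] y.1, t < b := mem_nhdsWithin_of_mem_nhds (Iio_mem_nhds hy2)
  obtain ⟨c, hc, hcs⟩ := mem_nhdsGT_iff_exists_Ioo_subset.1 (h1.and (h2.and h3))
  have hsub : Ioo y.1 c ⊆ Ico 0 L := fun t ht => by
    have h4 : t < b := (hcs ht).2.2
    exact ⟨by linarith [ht.1], by linarith⟩
  obtain ⟨t, ht, ht'⟩ := exists_mem_of_ae_restrict isOpen_Ioo (nonempty_Ioo.2 hc) hsub h
  obtain ⟨h5, h6, h7⟩ := hcs ht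
  have hne : γ t ≠ γ y.1 := hγ.apply_ne_of_mem_Ioo ⟨ht.1, by linarith [(hsub ht).2]⟩
  have h8 := hγ.arrivalAngle_mem hD hne
  have h9 : (t, arrivalAngle γ y.1 t) ∈ Ioo a b ×ˢ Ioo (-δ) δ :=
    ⟨⟨by linarith [ht.1], h7⟩, by simpa using by linarith [h8.1], h6⟩
  have h10 := ht' (by rw [hwin]; exact ⟨(hγ.chordAngle_mem hD hne).1, h5⟩)
  rw [indicator_of_mem h9] at h10
  exact one_ne_zero h10

theorem chordOp_ne_zero_of_mem_Icc (hγ : IsC2ArcLengthParam D L γ) {f : ℝ × ℝ → ℝ≥0∞}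
    (h : ∀ y ∈ phaseSpace L, chordOp L γ ε f y ≠ 0) :
    ∀ y ∈ Icc 0 L ×ˢ Icc 0 Real.pi, chordOp L γ ε f y ≠ 0 := by
  rintro ⟨s, θ⟩ ⟨⟨hs0, hsL⟩, hθ⟩
  rcases hsL.lt_or_eq with hs | rfl
  · exact h _ ⟨⟨hs0, hs⟩, hθ⟩
  · have h1 := chordOp_add_length (ε := ε) hγ f 0 θ
    rw [zero_add] at h1
    simp only
    rw [h1]
    exact h _ ⟨⟨le_rfl, hγ.length_pos⟩, hθ⟩

/-- A neighbourhood of a tangent vector which supports a function with positive iterates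
is charged by all sufficiently high powers, uniformly. -/
theorem exists_forall_iterate_chordOp_box_ne_zero (hγ : IsC2ArcLengthParam D L γ)
    (hD : IsStrictlyConvexDomain D) (hε : 0 < ε) (hε' : ε < Real.pi / 2) {a b δ : ℝ}
    (ha : 0 ≤ a) (hab : a < b) (hb : b ≤ L) (hδ : 0 < δ) (hδε : δ ≤ ε) :
    ∃ N, ∀ n ≥ N, ∀ y ∈ phaseSpace L,
      (chordOp L γ ε)^[n] ((Ioo a b ×ˢ Ioo (-δ) δ).indicator 1) y ≠ 0 := by
  set B : Set (ℝ × ℝ) := Ioo a b ×ˢ Ioo (-δ) δ with hB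
  have hBo : IsOpen B := isOpen_Ioo.prod isOpen_Ioo
  have hm : Measurable (B.indicator (1 : ℝ × ℝ → ℝ≥0∞)) :=
    measurable_one.indicator hBo.measurableSet
  have hlsc : LowerSemicontinuous (B.indicator (1 : ℝ × ℝ → ℝ≥0∞)) :=
    hBo.lowerSemicontinuous_indicator zero_le_one
  have hstep : ∀ y : ℝ × ℝ, B.indicator (1 : ℝ × ℝ → ℝ≥0∞) y ≠ 0 →
      chordOp L γ ε (B.indicator 1) y ≠ 0 := fun y hy =>
    chordOp_box_ne_zero hγ hD hε hε' ha hb hδε (mem_of_indicator_ne_zero hy)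
  have hmono : ∀ n y, y ∈ phaseSpace L → (chordOp L γ ε)^[n] (B.indicator 1) y ≠ 0 →
      (chordOp L γ ε)^[n + 1] (B.indicator 1) y ≠ 0 := by
    intro n y hy h
    rw [Function.iterate_succ_apply]
    exact iterate_chordOp_pos_of_pos hγ hD hε hε' hm (measurable_chordOp hγ hm)
      (fun y _ => hstep y) n y hy h
  -- The exponent starts at 1: after one step the function is `L`-periodic in `s`, and monotonicity
  -- in `n` holds on the whole plane rather than on the phase space only.
  set U : ℕ → Set (ℝ × ℝ) := fun n => {y | (chordOp L γ ε)^[n + 1] (B.indicator 1) y ≠ 0} with hU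
  have hUmono : Monotone U := by
    refine monotone_nat_of_le_succ fun n y hy => ?_
    simp only [hU, mem_ofPred_eq] at hy ⊢
    rw [Function.iterate_succ_apply'] at hy ⊢
    exact chordOp_pos_of_pos hγ hD hε hε' (measurable_iterate_chordOp hγ hm n)
      (measurable_iterate_chordOp hγ hm (n + 1)) (hmono n) hy
  have hUo : ∀ n, IsOpen (U n) := fun n => by
    have := (lowerSemicontinuous_iterate_chordOp (ε := ε) hγ hD hlsc (n + 1)).isOpen_preimage 0
    refine (congrArg IsOpen ?_).mp this
    ext y
    simp [hU, pos_iff_ne_zero]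
  have hbase : ∀ y ∈ phaseSpace L, ∃ n, y ∈ U n := by
    intro y hy
    have hz : ((a + b) / 2, min (δ / 2) (Real.pi / 2)) ∈ B ∩ Ioo 0 L ×ˢ Ioo 0 Real.pi := by
      have h1 := Real.pi_pos
      have h2 : 0 < min (δ / 2) (Real.pi / 2) := lt_min (by linarith) (by linarith)
      have h3 : min (δ / 2) (Real.pi / 2) ≤ δ / 2 := min_le_left _ _
      have h4 : min (δ / 2) (Real.pi / 2) ≤ Real.pi / 2 := min_le_right _ _
      refine ⟨⟨⟨?_, ?_⟩, ?_, ?_⟩, ⟨?_, ?_⟩, ?_, ?_⟩ <;> simp only <;> linarith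
    obtain ⟨n, hn⟩ := exists_iterate_chordOp_ne_zero hγ hD hε hε' hBo hz.1 hz.2 hy
    exact ⟨n, hmono n y hy hn⟩
  have hcover : Icc 0 L ×ˢ Icc 0 Real.pi ⊆ ⋃ n, U n := by
    rintro ⟨s, θ⟩ ⟨⟨hs0, hsL⟩, hθ⟩
    rcases hsL.lt_or_eq with hs | rfl
    · exact mem_iUnion.2 (hbase _ ⟨⟨hs0, hs⟩, hθ⟩)
    · obtain ⟨n, hn⟩ := hbase (0, θ) ⟨⟨le_rfl, hγ.length_pos⟩, hθ⟩
      refine mem_iUnion.2 ⟨n, ?_⟩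
      simp only [hU, mem_ofPred_eq] at hn ⊢
      rw [Function.iterate_succ_apply'] at hn ⊢
      rwa [← chordOp_add_length hγ _ 0 θ, zero_add] at hn
  obtain ⟨N, hN⟩ := (isCompact_Icc.prod isCompact_Icc).elim_directed_cover U hUo hcover
    (directed_of_isDirected_le hUmono)
  refine ⟨N + 1, fun n hn y hy => ?_⟩
  obtain ⟨k, rfl⟩ := Nat.exists_eq_add_of_le' (le_trans (Nat.le_add_left 1 N) hn)
  exact hUmono (Nat.le_of_succ_le_succ hn) (hN ⟨Ico_subset_Icc_self hy.1, hy.2⟩)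

theorem exists_pos_le_of_ne_zero {X : Set (ℝ × ℝ)} (hX : IsCompact X) {f : ℝ × ℝ → ℝ≥0∞}
    (hf : LowerSemicontinuous f) (h : ∀ y ∈ X, f y ≠ 0) :
    ∃ c : ℝ≥0, 0 < c ∧ ∀ y ∈ X, (c : ℝ≥0∞) ≤ f y := by
  rcases X.eq_empty_or_nonempty with rfl | hne
  · exact ⟨1, one_pos, by simp⟩
  obtain ⟨x, hx, hmin⟩ := (hf.lowerSemicontinuousOn X).exists_isMinOn hne hX
  obtain ⟨c, hc0, hc⟩ := ENNReal.lt_iff_exists_nnreal_btwn.1 (pos_iff_ne_zero.2 (h x hx))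
  exact ⟨c, by exact_mod_cast hc0, fun y hy => hc.le.trans (hmin hy)⟩

/-- The uniform minorization (Doeblin) condition. -/
theorem exists_minorization (hγ : IsC2ArcLengthParam D L γ) (hD : IsStrictlyConvexDomain D)
    (hε : 0 < ε) (hε' : ε < Real.pi / 2) :
    ∃ n : ℕ, 0 < n ∧ ∃ c : ℝ≥0, 0 < c ∧ ∀ A ⊆ phaseSpace L, MeasurableSet A →
      ∀ y ∈ phaseSpace L, c * volume A ≤ (chordOp L γ ε)^[n] (angleOp ε (A.indicator 1)) y := by
  have hL := hγ.length_pos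
  set X : Set (ℝ × ℝ) := Icc 0 L ×ˢ Icc 0 Real.pi with hX
  have hXc : IsCompact X := isCompact_Icc.prod isCompact_Icc
  choose! W hW V hVo hVne c hc hcA using fun z (hz : z ∈ X) =>
    exists_local_minorization hγ hD hε hz.2
  have hVlsc : ∀ z ∈ X, LowerSemicontinuous ((V z).indicator (1 : ℝ × ℝ → ℝ≥0∞)) := fun z hz =>
    (hVo z hz).lowerSemicontinuous_indicator zero_le_one
  obtain ⟨F, hFX, hF⟩ := hXc.elim_nhds_subcover W hW
  have hy0 : (L / 2, 0) ∈ phaseSpace L := ⟨⟨by linarith, by linarith⟩, le_rfl, Real.pi_pos.le⟩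
  have hreach : ∀ z ∈ X, ∃ m, (chordOp L γ ε)^[m] ((V z).indicator 1) (L / 2, 0) ≠ 0 := by
    intro z hz
    obtain ⟨z', hz'⟩ := hVne z hz
    exact exists_iterate_chordOp_ne_zero hγ hD hε hε' (hVo z hz) hz'.1 hz'.2 hy0
  choose! m hm using hreach
  have hO : {y | ∀ z ∈ F, (chordOp L γ ε)^[m z] ((V z).indicator 1) y ≠ 0} ∈
      𝓝 ((L / 2, 0) : ℝ × ℝ) := by
    refine (Filter.eventually_all_finset F).2 fun z hz => ?_
    have h1 := lowerSemicontinuous_iterate_chordOp (ε := ε) hγ hD (hVlsc z (hFX z hz)) (m z)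
      (L / 2, 0) 0 (pos_iff_ne_zero.2 (hm z (hFX z hz)))
    filter_upwards [h1] with y hy using hy.ne'
  obtain ⟨r, hr, hrO⟩ := Metric.mem_nhds_iff.1 hO
  -- The bounds keep the box inside the neighbourhood where all target sets are reachable, within
  -- the reach of `chordOp_box_ne_zero`, and over [0, L].
  set δ := min r (min ε (L / 2)) with hδ
  have hδ0 : 0 < δ := lt_min hr (lt_min hε (by linarith))
  have hδr : δ ≤ r := min_le_left _ _
  have hδε : δ ≤ ε := (min_le_right _ _).trans (min_le_left _ _)
  have hδL : δ ≤ L / 2 := (min_le_right _ _).trans (min_le_right _ _)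
  obtain ⟨N, hN⟩ := exists_forall_iterate_chordOp_box_ne_zero hγ hD hε hε'
    (a := L / 2 - δ) (b := L / 2 + δ) (by linarith) (by linarith) (by linarith) hδ0 hδε
  set B : Set (ℝ × ℝ) := Ioo (L / 2 - δ) (L / 2 + δ) ×ˢ Ioo (-δ) δ with hB
  have hBm : Measurable (B.indicator (1 : ℝ × ℝ → ℝ≥0∞)) :=
    measurable_one.indicator (measurableSet_Ioo.prod measurableSet_Ioo)
  have hBO : ∀ y ∈ B, ∀ z ∈ F, (chordOp L γ ε)^[m z] ((V z).indicator 1) y ≠ 0 := by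
    intro y hy
    refine hrO (Metric.ball_subset_ball hδr ?_)
    rw [← ball_prod_same, Real.ball_eq_Ioo, Real.ball_eq_Ioo, zero_sub, zero_add]
    exact hy
  -- A common time: for each `z`, the first `n - m z ≥ N` rounds charge the box, and `m z` further
  -- rounds lead from the box to `V z`. The extra 1 ensures a last application of `chordOp`, needed
  -- for periodicity.
  set n := N + 1 + ∑ z ∈ F, m z with hn
  have hpos : ∀ z ∈ F, ∀ y ∈ X, (chordOp L γ ε)^[n] ((V z).indicator 1) y ≠ 0 := by
    intro z hz
    have hVm := (hVlsc z (hFX z hz)).measurable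
    have h1 : m z ≤ ∑ z ∈ F, m z := Finset.single_le_sum (f := m) (fun _ _ => Nat.zero_le _) hz
    obtain ⟨k, hk⟩ : ∃ k, n = k + 1 := ⟨N + ∑ z ∈ F, m z, by omega⟩
    have h2 : ∀ y ∈ phaseSpace L, (chordOp L γ ε)^[n] ((V z).indicator 1) y ≠ 0 := by
      intro y hy
      obtain ⟨j, hj⟩ : ∃ j, n = j + m z := ⟨n - m z, by omega⟩
      rw [hj, Function.iterate_add_apply]
      exact iterate_chordOp_pos_of_pos hγ hD hε hε' hBm (measurable_iterate_chordOp hγ hVm (m z))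
        (fun y _ hy' => hBO y (mem_of_indicator_ne_zero hy') z hz) j y hy (hN j (by omega) y hy)
    rw [hk] at h2 ⊢
    simp only [Function.iterate_succ_apply'] at h2 ⊢
    exact chordOp_ne_zero_of_mem_Icc hγ h2
  have hmin := fun z (hz : z ∈ F) => exists_pos_le_of_ne_zero hXc
    (lowerSemicontinuous_iterate_chordOp (ε := ε) hγ hD (hVlsc z (hFX z hz)) n) (hpos z hz)
  choose! d hd hdle using hmin
  -- Each `volume (A ∩ W z)` is at most `(c z * d z)⁻¹ * v`, and these pieces cover `A`; the summand
  -- 1 makes `S` positive even for an empty sum.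
  set S : ℝ≥0 := ∑ z ∈ F, (c z * d z)⁻¹ + 1 with hS
  refine ⟨n + 1, n.succ_pos, S⁻¹, by positivity, fun A hA hAm y hy => ?_⟩
  set v := (chordOp L γ ε)^[n + 1] (angleOp ε (A.indicator 1)) y with hv
  have hyX : y ∈ X := ⟨Ico_subset_Icc_self hy.1, hy.2⟩
  have hAX : A ⊆ X := hA.trans (prod_mono Ico_subset_Icc_self Subset.rfl)
  have hAfin : volume A ≠ ∞ := ((measure_mono hAX).trans_lt hXc.measure_lt_top).ne
  have hz : ∀ z ∈ F, volume (A ∩ W z) ≤ ((c z * d z)⁻¹ : ℝ≥0) * v := by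
    intro z hz
    have hcd : c z * d z ≠ 0 := (mul_pos (hc z (hFX z hz)) (hd z hz)).ne'
    have h1 : (fun y => c z * volume (A ∩ W z) * (V z).indicator 1 y) ≤
        chordOp L γ ε (angleOp ε (A.indicator 1)) := by
      intro y
      by_cases hyV : y ∈ V z
      · simpa [hyV] using hcA z (hFX z hz) A hA hAm y hyV
      · simp [hyV]
    have h2 := (monotone_chordOp (L := L) (γ := γ) (ε := ε)).iterate n h1 y
    rw [← Function.iterate_succ_apply (chordOp L γ ε), iterate_chordOp_const_mul
      (ENNReal.mul_ne_top ENNReal.coe_ne_top (measure_ne_top_of_subset inter_subset_left hAfin))]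
      at h2
    have h3 : ((c z * d z : ℝ≥0) : ℝ≥0∞) * volume (A ∩ W z) ≤ v := by
      refine le_trans ?_ h2
      rw [ENNReal.coe_mul, mul_right_comm]
      exact mul_le_mul_right (hdle z hz y hyX) _
    rw [ENNReal.coe_inv hcd, mul_comm, ← div_eq_mul_inv]
    rw [ENNReal.le_div_iff_mul_le (Or.inl (by exact_mod_cast hcd)) (Or.inl ENNReal.coe_ne_top),
      mul_comm]
    exact h3
  have hsum : volume A ≤ S * v := by
    calc volume A ≤ volume (⋃ z ∈ F, A ∩ W z) := by
          refine measure_mono fun p hp => ?_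
          obtain ⟨z, hz, hpz⟩ := mem_iUnion₂.1 (hF (hAX hp))
          exact mem_iUnion₂.2 ⟨z, hz, hp, hpz⟩
      _ ≤ ∑ z ∈ F, volume (A ∩ W z) := measure_biUnion_finset_le _ _
      _ ≤ ∑ z ∈ F, ((c z * d z)⁻¹ : ℝ≥0) * v := Finset.sum_le_sum hz
      _ = (∑ z ∈ F, (c z * d z)⁻¹ : ℝ≥0) * v := by
          rw [← Finset.sum_mul]
          push_cast
          rfl
      _ ≤ S * v := by
          gcongr
          exact le_self_add
  have hS0 : S ≠ 0 := by positivity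
  rw [ENNReal.coe_inv hS0, mul_comm, ← div_eq_mul_inv]
  exact ENNReal.div_le_of_le_mul' hsum

/-! ### The transition density and the passage from the process to the operators -/

theorem measurableSet_phaseSpace : MeasurableSet (phaseSpace L) :=
  measurableSet_Ico.prod measurableSet_Icc

/-- The density of two steps of the process, started from a state at which the angle is about to
be perturbed. -/
def stepDensity (γ : ℝ → ℂ) (ε : ℝ) (z y : ℝ × ℝ) : ℝ≥0∞ :=
  ENNReal.ofReal (1 / (2 * ε)) * (ENNReal.ofReal (chordAngleDeriv γ y.1 z.1) *
    (window ε y.2).indicator (fun _ => ENNReal.ofReal (1 / (2 * ε)) *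
      (window ε (arrivalAngle γ y.1 z.1)).indicator 1 z.2) (chordAngle γ y.1 z.1))

theorem measurable_stepDensity (hγ : IsC2ArcLengthParam D L γ) :
    Measurable (Function.uncurry (stepDensity γ ε)) := by
  have hpt : Measurable fun p : (ℝ × ℝ) × (ℝ × ℝ) => (p.2.1, p.1.1) := by fun_prop
  have hm1 := hγ.measurable_chordAngle.comp hpt
  have hm2 := hγ.measurable_arrivalAngle.comp hpt
  have hm3 := hγ.measurable_chordAngleDeriv.comp hpt
  have hs1 : MeasurableSet {p : (ℝ × ℝ) × (ℝ × ℝ) |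
      chordAngle γ p.2.1 p.1.1 ∈ window ε p.2.2} := by
    have h1 : Measurable fun p : (ℝ × ℝ) × (ℝ × ℝ) => (p.2.2, chordAngle γ p.2.1 p.1.1) :=
      Measurable.prodMk (by fun_prop) hm1
    exact h1 isOpen_window_rel.measurableSet
  have hs2 : MeasurableSet {p : (ℝ × ℝ) × (ℝ × ℝ) |
      p.1.2 ∈ window ε (arrivalAngle γ p.2.1 p.1.1)} := by
    have h1 : Measurable fun p : (ℝ × ℝ) × (ℝ × ℝ) => (arrivalAngle γ p.2.1 p.1.1, p.1.2) :=
      Measurable.prodMk hm2 (by fun_prop)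
    exact h1 isOpen_window_rel.measurableSet
  have hi : Measurable fun p : (ℝ × ℝ) × (ℝ × ℝ) =>
      (window ε (arrivalAngle γ p.2.1 p.1.1)).indicator (1 : ℝ → ℝ≥0∞) p.1.2 := by
    have h1 : Measurable ({p : (ℝ × ℝ) × (ℝ × ℝ) |
      p.1.2 ∈ window ε (arrivalAngle γ p.2.1 p.1.1)}.indicator (fun _ => (1 : ℝ≥0∞))) :=
      measurable_const.indicator hs2
    exact h1
  exact (hm3.ennreal_ofReal.mul ((hi.const_mul _).indicator hs1)).const_mul _

theorem chordOp_angleOp_eq_lintegral (hγ : IsC2ArcLengthParam D L γ)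
    (hε' : ε < Real.pi / 2) {A : Set (ℝ × ℝ)} (hA : A ⊆ phaseSpace L) (hAm : MeasurableSet A)
    (y : ℝ × ℝ) : chordOp L γ ε (angleOp ε (A.indicator 1)) y =
      ∫⁻ z in A, stepDensity γ ε z y := by
  have hd : Measurable fun z => stepDensity γ ε z y := (measurable_stepDensity hγ).of_uncurry_right
  have h1 : ∫⁻ z in A, stepDensity γ ε z y =
      ∫⁻ z in phaseSpace L, A.indicator (fun z => stepDensity γ ε z y) z := by
    rw [lintegral_indicator hAm, Measure.restrict_restrict hAm, inter_eq_left.2 hA]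
  rw [h1, lintegral_phaseSpace (hd.indicator hAm), chordOp,
    ← lintegral_const_mul' _ _ ENNReal.ofReal_ne_top]
  refine lintegral_congr fun t => ?_
  have hAt : Measurable fun u : ℝ => A.indicator (1 : ℝ × ℝ → ℝ≥0∞) (t, u) :=
    (measurable_one.indicator hAm).comp (by fun_prop)
  by_cases hw : chordAngle γ y.1 t ∈ window ε y.2
  · rw [indicator_of_mem hw, angleOp, ← mul_assoc, ← mul_assoc,
      ← lintegral_indicator (measurableSet_window _ _),
      ← lintegral_indicator measurableSet_Ioo, ← lintegral_const_mul']
    · refine lintegral_congr fun u => ?_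
      by_cases hu : u ∈ window ε (arrivalAngle γ y.1 t)
      · have hu' := window_subset hε' _ hu
        change _ * (window ε (arrivalAngle γ y.1 t)).indicator _ u = _
        rw [indicator_of_mem hu, indicator_of_mem hu']
        by_cases hAu : (t, u) ∈ A
        · simp [hAu, stepDensity, hw, hu, mul_assoc]
        · simp [hAu]
      · change _ * (window ε (arrivalAngle γ y.1 t)).indicator _ u = _
        rw [indicator_of_notMem hu, mul_zero]
        symm
        rw [indicator_apply_eq_zero]
        intro _
        rw [indicator_apply_eq_zero]
        intro _
        simp [stepDensity, hu]
    · exact ENNReal.mul_ne_top (ENNReal.mul_ne_top ENNReal.ofReal_ne_top ENNReal.ofReal_ne_top)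
        ENNReal.ofReal_ne_top
  · have h0 : ∀ u, A.indicator (fun z => stepDensity γ ε z y) (t, u) = 0 := fun u => by
      rw [indicator_apply_eq_zero]
      intro _
      simp [stepDensity, hw]
    simp [hw, h0]

theorem measurable_iterate_chordOp_param (hγ : IsC2ArcLengthParam D L γ) {Z : Type*}
    [MeasurableSpace Z] {F : Z → ℝ × ℝ → ℝ≥0∞} (hF : Measurable (Function.uncurry F)) (n : ℕ) :
    Measurable fun p : Z × (ℝ × ℝ) => (chordOp L γ ε)^[n] (F p.1) p.2 := by
  induction n with
  | zero => exact hF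
  | succ n ih =>
    simp only [Function.iterate_succ_apply']
    exact measurable_chordOp_param hγ (F := fun z => (chordOp L γ ε)^[n] (F z)) ih

theorem chordOp_lintegral (hγ : IsC2ArcLengthParam D L γ) {Z : Type*} [MeasurableSpace Z]
    {μ : Measure Z} [SFinite μ] {F : Z → ℝ × ℝ → ℝ≥0∞} (hF : Measurable (Function.uncurry F))
    (y : ℝ × ℝ) : chordOp L γ ε (fun y => ∫⁻ z, F z y ∂μ) y = ∫⁻ z, chordOp L γ ε (F z) y ∂μ := by
  have hpt : Measurable fun p : ℝ × Z => (y.1, p.1) := by fun_prop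
  have hFt : Measurable fun p : ℝ × Z => F p.2 (p.1, arrivalAngle γ y.1 p.1) :=
    hF.comp (measurable_snd.prodMk (measurable_fst.prodMk (hγ.measurable_arrivalAngle.comp hpt)))
  have hset : MeasurableSet {p : ℝ × Z | chordAngle γ y.1 p.1 ∈ window ε y.2} :=
    (hγ.measurable_chordAngle.comp hpt) (measurableSet_window ε y.2)
  simp only [chordOp]
  rw [lintegral_const_mul' _ _ ENNReal.ofReal_ne_top, lintegral_lintegral_swap]
  · congr 1
    refine lintegral_congr fun t => ?_
    rw [lintegral_const_mul' _ _ ENNReal.ofReal_ne_top]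
    congr 1
    by_cases h : chordAngle γ y.1 t ∈ window ε y.2
    · simp [h]
    · simp [h]
  · exact (((hγ.measurable_chordAngleDeriv.comp hpt).ennreal_ofReal.mul
      (hFt.indicator hset)).comp measurable_swap).aemeasurable

theorem iterate_chordOp_lintegral (hγ : IsC2ArcLengthParam D L γ) {Z : Type*} [MeasurableSpace Z]
    {μ : Measure Z} [SFinite μ] {F : Z → ℝ × ℝ → ℝ≥0∞} (hF : Measurable (Function.uncurry F))
    (n : ℕ) : (chordOp L γ ε)^[n] (fun y => ∫⁻ z, F z y ∂μ) =
      fun y => ∫⁻ z, (chordOp L γ ε)^[n] (F z) y ∂μ := by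
  induction n with
  | zero => rfl
  | succ n ih =>
    funext y
    simp only [Function.iterate_succ_apply', ih]
    exact chordOp_lintegral hγ (F := fun z => (chordOp L γ ε)^[n] (F z))
      (measurable_iterate_chordOp_param hγ hF n) y

theorem angleOp_one (hε : 0 < ε) (y : ℝ × ℝ) : angleOp ε 1 y = 1 := by
  have h : volume (window ε y.2) = ENNReal.ofReal (2 * ε) := by
    rw [window, Real.volume_Ioo]
    congr 1
    ring
  simp only [angleOp, Pi.one_apply, lintegral_one, Measure.restrict_apply_univ]
  rw [h, ← ENNReal.ofReal_mul (by positivity)]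
  rw [one_div_mul_cancel (by positivity), ENNReal.ofReal_one]

/-- The chord weights are a uniform law on the window in other coordinates, so the total mass is 1.
This keeps the densities almost everywhere finite. -/
theorem chordOp_one (hγ : IsC2ArcLengthParam D L γ) (hD : IsStrictlyConvexDomain D)
    (hε : 0 < ε) (hε' : ε < Real.pi / 2) (y : ℝ × ℝ) : chordOp L γ ε 1 y = 1 := by
  have h := hγ.lintegral_chordAngle hD y.1 ((window ε y.2).indicator 1)
  rw [lintegral_indicator (measurableSet_window _ _),
    Measure.restrict_restrict (measurableSet_window _ _),
    inter_eq_left.2 (window_subset hε' y.2)] at h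
  rw [← angleOp_one hε y, angleOp]
  change _ = _ * ∫⁻ u in window ε y.2, (1 : ℝ → ℝ≥0∞) u
  rw [← h]
  rfl

theorem iterate_chordOp_angleOp_le_one (hγ : IsC2ArcLengthParam D L γ)
    (hD : IsStrictlyConvexDomain D) (hε : 0 < ε) (hε' : ε < Real.pi / 2) (A : Set (ℝ × ℝ)) (n : ℕ)
    (y : ℝ × ℝ) : (chordOp L γ ε)^[n] (angleOp ε (A.indicator 1)) y ≤ 1 := by
  induction n generalizing y with
  | zero =>
    rw [← angleOp_one hε y]
    simp only [Function.iterate_zero, id, angleOp]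
    refine mul_le_mul_right (lintegral_mono fun u => ?_) _
    simpa using indicator_one_mono (S := A) (S' := univ) fun _ => mem_univ (y.1, u)
  | succ n ih =>
    rw [Function.iterate_succ_apply', ← chordOp_one hγ hD hε hε' y]
    exact monotone_chordOp (fun y => ih y) y

/-- Truncation keeps the perturbed angles in [0, π], so restricting to the phase space loses no
mass. -/
theorem setLIntegral_transition (hε' : ε < Real.pi / 2) {x : ℝ × ℝ}
    (hx : billiardMap D L γ x ∈ phaseSpace L) (g : ℝ × ℝ → ℝ≥0∞) :
    ∫⁻ y in phaseSpace L, g y ∂(transition D L γ ε x) = angleOp ε g (billiardMap D L γ x) := by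
  set y := billiardMap D L γ x
  have h := truncAngle_mem hε' y.2
  have hpre : (fun u : ℝ => (y.1, u)) ⁻¹' phaseSpace L = Icc 0 Real.pi := by
    ext u
    exact ⟨fun hu => hu.2, fun hu => ⟨hx.1, hu⟩⟩
  have hsub : Icc (truncAngle ε y.2 - ε) (truncAngle ε y.2 + ε) ⊆ Icc 0 Real.pi :=
    Icc_subset_Icc (by linarith [h.1]) (by linarith [h.2])
  have hemb : MeasurableEmbedding fun u : ℝ => (y.1, u) := measurableEmbedding_prodMk_left y.1
  change ∫⁻ y in phaseSpace L, g y ∂(perturbation ε y) = _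
  rw [perturbation, Measure.restrict_smul, lintegral_smul_measure, hemb.restrict_map,
    hemb.lintegral_map, hpre, Measure.restrict_restrict measurableSet_Icc,
    inter_eq_right.2 hsub, ← restrict_Ioo_eq_restrict_Icc]
  rfl

/-- The change of variables from angle to end point, under which T becomes explicit. -/
theorem angleOp_comp_billiardMap (hγ : IsC2ArcLengthParam D L γ) (hD : IsStrictlyConvexDomain D)
    (hε' : ε < Real.pi / 2) (h : ℝ × ℝ → ℝ≥0∞) (y : ℝ × ℝ) :
    angleOp ε (fun y => h (billiardMap D L γ y)) y = chordOp L γ ε h y := by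
  have h1 := hγ.lintegral_chordAngle hD y.1
    ((window ε y.2).indicator fun u => h (billiardMap D L γ (y.1, u)))
  rw [lintegral_indicator (measurableSet_window _ _),
    Measure.restrict_restrict (measurableSet_window _ _),
    inter_eq_left.2 (window_subset hε' y.2)] at h1
  rw [angleOp, chordOp, ← h1]
  congr 1
  refine lintegral_congr_ae ?_
  filter_upwards [hγ.ae_chord_ne y.1, ae_restrict_mem measurableSet_Ico] with t h2 h3
  by_cases hw : chordAngle γ y.1 t ∈ window ε y.2
  · rw [indicator_of_mem hw, indicator_of_mem hw, hγ.billiardMap_chordAngle hD h3 h2]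
  · rw [indicator_of_notMem hw, indicator_of_notMem hw]

/-- The transition probabilities in terms of the operators `chordOp` and `angleOp`. -/
theorem nStep_succ_eq (hγ : IsC2ArcLengthParam D L γ) (hD : IsStrictlyConvexDomain D)
    (hε' : ε < Real.pi / 2) (A : Set (ℝ × ℝ)) (n : ℕ) :
    ∀ x ∈ phaseSpace L, nStep D L γ ε (n + 1) x A =
      (chordOp L γ ε)^[n] (angleOp ε (A.indicator 1)) (billiardMap D L γ x) := by
  induction n with
  | zero =>
    intro x hx
    rw [nStep, setLIntegral_transition hε' (hγ.billiardMap_mem_phaseSpace hD hx)]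
    rfl
  | succ n ih =>
    intro x hx
    have hTx := hγ.billiardMap_mem_phaseSpace hD hx
    rw [nStep, setLIntegral_transition hε' hTx, Function.iterate_succ_apply',
      ← angleOp_comp_billiardMap hγ hD hε', angleOp, angleOp]
    congr 1
    refine setLIntegral_congr_fun (measurableSet_window _ _) fun u hu => ?_
    exact ih _ ⟨hTx.1, Ioo_subset_Icc_self (window_subset hε' _ hu)⟩

/-- Away from tangent vectors, the preimage of a Borel set is the image of a Borel set of parameter
pairs under an injective Borel map, hence Borel (Lusin–Souslin); tangent vectors are fixed. -/
theorem measurable_indicator_billiardMap (hγ : IsC2ArcLengthParam D L γ)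
    (hD : IsStrictlyConvexDomain D) :
    Measurable ((phaseSpace L).indicator (billiardMap D L γ)) := by
  intro B hB
  have hkey : MeasurableSet (billiardMap D L γ ⁻¹' B ∩ phaseSpace L) := by
    set S : Set (ℝ × ℝ) := {p | (p.1 ∈ Ico 0 L ∧ p.2 ∈ Ico 0 L) ∧ γ p.2 ≠ γ p.1 ∧
      (p.2, arrivalAngle γ p.1 p.2) ∈ B} with hS
    have hSm : MeasurableSet S := by
      refine (measurableSet_Ico.prod measurableSet_Ico).inter (MeasurableSet.inter ?_ ?_)
      · exact (measurableSet_eq_fun (hγ.continuous.measurable.comp measurable_snd)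
          (hγ.continuous.measurable.comp measurable_fst)).compl
      · exact (measurable_snd.prodMk hγ.measurable_arrivalAngle) hB
    have hinj : InjOn (fun p : ℝ × ℝ => (p.1, chordAngle γ p.1 p.2)) S := by
      rintro ⟨s, t⟩ ⟨⟨-, ht⟩, hne, -⟩ ⟨s', t'⟩ ⟨⟨-, ht'⟩, hne', -⟩ h
      obtain ⟨rfl, h2⟩ := Prod.mk.inj h
      exact congrArg (Prod.mk s) (hγ.injOn_chordAngle hD s ⟨ht, hne⟩ ⟨ht', hne'⟩ h2)
    have himg := hSm.image_of_measurable_injOn (measurable_fst.prodMk hγ.measurable_chordAngle) hinj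
    have h0 : MeasurableSet (Ico 0 L ×ˢ ({0, Real.pi} : Set ℝ)) :=
      measurableSet_Ico.prod (by measurability)
    refine (congrArg MeasurableSet ?_).mp (himg.union (h0.inter hB))
    ext ⟨s, θ⟩
    constructor
    · rintro (⟨⟨s', t⟩, ⟨⟨hs, ht⟩, hne, hB'⟩, he⟩ | ⟨⟨hs, hθ⟩, hB'⟩)
      · obtain ⟨rfl, rfl⟩ := Prod.mk.inj he
        refine ⟨?_, hs, hγ.chordAngle_mem_Icc hD _ _⟩
        rw [mem_preimage, hγ.billiardMap_chordAngle hD ht hne]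
        exact hB'
      · have hθ : θ = 0 ∨ θ = Real.pi := hθ
        refine ⟨?_, hs, ?_⟩
        · rw [mem_preimage, hγ.billiardMap_tangent hD hs hθ]
          exact hB'
        · rcases hθ with rfl | rfl <;> simp [Real.pi_pos.le]
    · rintro ⟨hB', hs, h1, h2⟩
      by_cases hθ : θ = 0 ∨ θ = Real.pi
      · rw [mem_preimage, hγ.billiardMap_tangent hD hs hθ] at hB'
        exact Or.inr ⟨⟨hs, hθ⟩, hB'⟩
      · push Not at hθ
        obtain ⟨t, ht, hne, rfl⟩ := hγ.exists_chordAngle_eq hD s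
          (⟨lt_of_le_of_ne h1 hθ.1.symm, lt_of_le_of_ne h2 hθ.2⟩ : θ ∈ Ioo 0 Real.pi)
        rw [mem_preimage, hγ.billiardMap_chordAngle hD ht hne] at hB'
        exact Or.inl ⟨(s, t), ⟨⟨hs, ht⟩, hne, hB'⟩, rfl⟩
  rw [indicator_preimage, Set.ite]
  exact hkey.union ((measurable_zero hB).diff measurableSet_phaseSpace)

/-- A function whose integrals over measurable subsets of the phase space are bounded below by
`c` times Lebesgue measure is at least `c` almost everywhere. -/
theorem ae_le_of_forall_mul_volume_le {c : ℝ≥0} {f : ℝ × ℝ → ℝ≥0∞}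
    (h : ∀ A ⊆ phaseSpace L, MeasurableSet A → c * volume A ≤ ∫⁻ z in A, f z) :
    ∀ᵐ z ∂volume.restrict (phaseSpace L), (c : ℝ≥0∞) ≤ f z := by
  refine ae_le_of_forall_setLIntegral_le_of_sigmaFinite measurable_const fun A hA _ => ?_
  rw [Measure.restrict_restrict hA, setLIntegral_const]
  exact h _ inter_subset_right (hA.inter measurableSet_phaseSpace)

end Billiard

end

theorem proposition2 (D : Set ℂ) (L : ℝ) (γ : ℝ → ℂ)
    (hD : Billiard.IsStrictlyConvexDomain D)
    (hγ : Billiard.IsC2ArcLengthParam D L γ)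
    (ε : ℝ) (hε : 0 < ε) (hε' : ε < Real.pi / 2) :
    ∃ b : ℝ≥0, 0 < b ∧ ∃ N : ℕ, 0 < N ∧
      (∃ p : ℝ × ℝ → ℝ × ℝ → ℝ≥0, Billiard.IsTransitionDensity D L γ ε N p ∧
        ∀ x ∈ Billiard.phaseSpace L, ∀ y ∈ Billiard.phaseSpace L, b < p x y) ∧
      (∀ q : ℝ × ℝ → ℝ × ℝ → ℝ≥0, Billiard.IsTransitionDensity D L γ ε N q →
        ∀ x ∈ Billiard.phaseSpace L, ∀ᵐ y ∂(volume.restrict (Billiard.phaseSpace L)),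
          b < q x y) := by
  obtain ⟨n, hn, c, hc, hmin⟩ := Billiard.exists_minorization hγ hD hε hε'
  obtain ⟨m, rfl⟩ : ∃ m, n = m + 1 := ⟨n - 1, by omega⟩
  have hstep := Billiard.nStep_succ_eq hγ hD hε'
  have hlow : ∀ x ∈ Billiard.phaseSpace L, ∀ A ⊆ Billiard.phaseSpace L, MeasurableSet A →
      c * volume A ≤ Billiard.nStep D L γ ε (m + 1 + 1) x A := by
    intro x hx A hA hAm
    rw [hstep A (m + 1) x hx]
    exact hmin A hA hAm _ (hγ.billiardMap_mem_phaseSpace hD hx)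
  -- Halving `c` turns the lower bound `c ≤` into a strict one.
  refine ⟨c / 2, half_pos hc, m + 1 + 1, Nat.succ_pos _, ?_, ?_⟩
  · set g : ℝ × ℝ → ℝ × ℝ → ℝ≥0∞ := fun z y =>
      (Billiard.chordOp L γ ε)^[m] (Billiard.stepDensity γ ε z) y with hg
    have hgm : Measurable (Function.uncurry g) :=
      Billiard.measurable_iterate_chordOp_param hγ (Billiard.measurable_stepDensity hγ) m
    set T := (Billiard.phaseSpace L).indicator (Billiard.billiardMap D L γ) with hT
    have hTm : Measurable T := Billiard.measurable_indicator_billiardMap hγ hD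
    have hqm : Measurable fun q : (ℝ × ℝ) × (ℝ × ℝ) => (q.2, T q.1) := by fun_prop
    have hpm : Measurable (Function.uncurry g ∘ fun q : (ℝ × ℝ) × (ℝ × ℝ) => (q.2, T q.1)) :=
      hgm.comp hqm
    have hint : ∀ x ∈ Billiard.phaseSpace L, ∀ A ⊆ Billiard.phaseSpace L, MeasurableSet A →
        Billiard.nStep D L γ ε (m + 1 + 1) x A = ∫⁻ z in A, g z (T x) := by
      intro x hx A hA hAm
      have h1 : Billiard.chordOp L γ ε (Billiard.angleOp ε (A.indicator 1)) =
          fun y => ∫⁻ z in A, Billiard.stepDensity γ ε z y :=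
        funext (Billiard.chordOp_angleOp_eq_lintegral hγ hε' hA hAm)
      have h2 : T x = Billiard.billiardMap D L γ x := indicator_of_mem hx _
      rw [hstep A (m + 1) x hx, Function.iterate_succ_apply, h1, h2]
      exact congrFun (Billiard.iterate_chordOp_lintegral hγ
        (Billiard.measurable_stepDensity hγ) m) _
    -- The natural density is finite and at least `c` only almost everywhere; taking the maximum
    -- with `c` corrects it on a null set and makes the bound hold at every point.
    refine ⟨fun x z => max (g z (T x)).toNNReal c,
      ⟨hpm.ennreal_toNNReal.max measurable_const, fun x hx A hA hAm => ?_⟩,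
      fun x _ z _ => lt_of_lt_of_le (half_lt_self hc) (le_max_right _ _)⟩
    have hgx : Measurable fun z => g z (T x) := hgm.of_uncurry_right
    rw [hint x hx A hA hAm]
    have h1 : ∀ᵐ z ∂volume.restrict (Billiard.phaseSpace L), (c : ℝ≥0∞) ≤ g z (T x) :=
      Billiard.ae_le_of_forall_mul_volume_le fun A hA hAm => by
        rw [← hint x hx A hA hAm]
        exact hlow x hx A hA hAm
    have h2 : ∀ᵐ z ∂volume.restrict (Billiard.phaseSpace L), g z (T x) < ∞ := by
      refine ae_lt_top hgx ?_
      rw [← hint x hx _ Subset.rfl Billiard.measurableSet_phaseSpace, hstep _ (m + 1) x hx]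
      exact ne_top_of_le_ne_top ENNReal.one_ne_top
        (Billiard.iterate_chordOp_angleOp_le_one hγ hD hε hε' _ _ _)
    refine lintegral_congr_ae ?_
    filter_upwards [ae_restrict_of_ae_restrict_of_subset hA h1,
      ae_restrict_of_ae_restrict_of_subset hA h2] with z h3 h4
    rw [max_eq_left, ENNReal.coe_toNNReal h4.ne]
    rwa [← ENNReal.coe_le_coe, ENNReal.coe_toNNReal h4.ne]
  · intro q hq x hx
    have h1 : ∀ᵐ z ∂volume.restrict (Billiard.phaseSpace L), (c : ℝ≥0∞) ≤ q x z :=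
      Billiard.ae_le_of_forall_mul_volume_le fun A hA hAm => by
        rw [← hq.2 x hx A hA hAm]
        exact hlow x hx A hA hAm
    filter_upwards [h1] with z hz
    exact lt_of_lt_of_le (half_lt_self hc) (by exact_mod_cast hz)
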